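/- Let $f$ be a transcendental meromorphic function on $\mathbb{C}$ (that is, meromorphic in $\mathbb{C}$ and not a rational function). Write $T(r,\cdot)$ for the Nevanlinna characteristic and $N(r,\cdot)$ for the integrated counting function of poles, counted with multiplicity. Let $S(r,f)$ denote any quantity that is $o(T(r,f))$ as $r\to\infty$, $r\notin E$, for some set $E\subset(0,\infty)$ of finite Lebesgue measure ($E$ may differ at each occurrence). A small function of $f$ is a meromorphic function $b\not\equiv 0,\infty$ on $\mathbb{C}$ with $T(r,b)=S(r,f)$. Let $k\ge 1$, $q_0\ge 3$, $q_1,\dots,q_{k-1}\ge 0$ and $q_k\ge 1$ be integers, let $a$ and $\varphi$ be small functions of $f$, and let $$M[f]=a\,f^{q_0}(f')^{q_1}\cdots(f^{(k)})^{q_k}.$$ Then $$T(r,f)\le\frac{1}{q_0-2}\,N\!\left(r,\frac{1}{M[f]-\varphi}\right)+S(r,f).$$ -/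

import Mathlib

open Filter Asymptotics

noncomputable section

namespace Nevanlinna

/- A meromorphic function on the plane is a map `f : ℂ → ℂ` with `Meromorphic f`.  The values at
isolated points carry no information (Mathlib gives poles an arbitrary finite value), so two such
maps represent the same meromorphic function when they agree on a codiscrete set, i.e. off a closed
discrete set. -/

/-- The Nevanlinna characteristic `T(r, f) = m(r, f) + N(r, f)`. -/
def T (r : ℝ) (f : ℂ → ℂ) : ℝ := ValueDistribution.characteristic f ⊤ r

/-- The integrated counting function `N(r, f)` of the poles of `f`, counted with multiplicity. -/
def N (r : ℝ) (f : ℂ → ℂ) : ℝ := ValueDistribution.logCounting f ⊤ r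

/-- `f` is a rational function, as a meromorphic function. -/
def IsRational (f : ℂ → ℂ) : Prop :=
  ∃ p q : Polynomial ℂ, q ≠ 0 ∧ f =ᶠ[codiscrete ℂ] fun z => p.eval z / q.eval z

/-- A transcendental meromorphic function on the plane: meromorphic and not rational. -/
structure IsTranscendentalMeromorphic (f : ℂ → ℂ) : Prop where
  meromorphic : Meromorphic f
  not_isRational : ¬ IsRational f

/-- `s` is a quantity of type `S(r, f)`: `s(r) = o(T(r, f))` as `r → ∞` outside some set `E` of
positive real numbers of finite Lebesgue measure. -/
def IsSmallError (f : ℂ → ℂ) (s : ℝ → ℝ) : Prop :=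
  ∃ E : Set ℝ, E ⊆ Set.Ioi 0 ∧ MeasurableSet E ∧ MeasureTheory.volume E < ⊤ ∧
    s =o[atTop ⊓ 𝓟 Eᶜ] fun r => T r f

/-- `b` is a small function with respect to `f`: a meromorphic function on the plane, not
identically zero, with `T(r, b) = S(r, f)`.  (Not being identically infinite is part of
`Meromorphic b`.) -/
structure IsSmallFunction (f b : ℂ → ℂ) : Prop where
  meromorphic : Meromorphic b
  not_zero : ¬ b =ᶠ[codiscrete ℂ] 0
  small : IsSmallError f fun r => T r b

/-- The differential monomial `M[f] = a · f ^ q₀ · (f') ^ q₁ ⋯ (f⁽ᵏ⁾) ^ qₖ`; only the exponents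
`q 0, …, q k` enter. -/
def diffMonomial (a : ℂ → ℂ) (k : ℕ) (q : ℕ → ℕ) (f : ℂ → ℂ) : ℂ → ℂ :=
  fun z => a z * ∏ i ∈ Finset.range (k + 1), iteratedDeriv i f z ^ q i

end Nevanlinna

end

noncomputable section

namespace Nevanlinna

open Metric Real MeromorphicOn ValueDistribution Topology Set

/-! Write G = M[f]/φ and γ = q₀ + ⋯ + qₖ. The identity 1/G = 1 − (G'/G)·((G−1)/G') bounds m(r, 1/G)
by m(r, G'/G) + m(r, (G−1)/G') + O(1), and Jensen's formula turns m(r, (G−1)/G') into m(r, G'/(G−1))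
plus the integrated count of the divisor of (G−1)/G'. By the lemma on the logarithmic derivative,
m(r, 1/G) is at most that count up to S(r, f) (`proximity_inv_le_logDeriv`). Since M[f]/f^γ = a ∏
(f⁽ⁱ⁾/f)^qᵢ has small proximity function, γ m(r, 1/f) obeys the same bound.

The count is estimated point by point (`logCounting_divisor_sub_le`). The function (G−1)/G' has
order at most 1 at poles of f, order 1 at zeros of G−1, and order 1−m at a zero of G of order m; a
zero of f of order p forces m ≥ q₀p up to the zeros and poles of a and φ. Hence γ m(r, 1/f) + q₀
N(r, 1/f) ≤ N(r, 1/f) + N(r, f) + N(r, 1/(M[f]−φ)) + S(r, f). Adding (γ−q₀) N(r, 1/f) and using the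
first main theorem gives γ T(r, f) ≤ (γ−q₀+2) T(r, f) + N(r, 1/(M[f]−φ)) + S(r, f), which is the
claim. G must be nonconstant: otherwise M[f] would be a small function, and then T(r, f) = S(r, f).

Two classical facts are established on the way: the lemma on the logarithmic derivative, from the
differentiated Poisson–Jensen formula, a concavity argument and Borel's growth lemma; and log r =
o(T(r, f)) for transcendental f, which makes O(1) and O(log r) admissible errors. -/

/-! ### Logarithmic derivatives of zero-free analytic functions -/

/-- The logarithmic derivative of a zero-free analytic function is controlled by the mean of
`|log ‖h‖|` on a larger circle. -/
theorem norm_logDeriv_le_of_ne_zero {h : ℂ → ℂ} {R : ℝ} {w : ℂ}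
    (h₁ : AnalyticOnNhd ℂ h (closedBall 0 R)) (h₂ : ∀ u ∈ closedBall (0 : ℂ) R, h u ≠ 0)
    (hw : w ∈ ball (0 : ℂ) R) :
    ‖logDeriv h w‖ ≤ 2 * R / (R - ‖w‖) ^ 2 * circleAverage (fun z => |Real.log ‖h z‖|) 0 R := by
  have hR : 0 < R := pos_of_mem_ball hw
  have hwR : ‖w‖ < R := by simpa using hw
  have hharm : InnerProductSpace.HarmonicOnNhd (fun z => Real.log ‖h z‖) (closedBall 0 R) :=
    fun x hx => (h₁ x hx).harmonicAt_log_norm (h₂ x hx)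
  have hcont : ContinuousOn (fun z => Real.log ‖h z‖) (sphere 0 R) := by
    intro x hx
    have hx' := sphere_subset_closedBall hx
    exact ((h₁ x hx').continuousAt.norm.log (by simpa using h₂ x hx')).continuousWithinAt
  have hci : CircleIntegrable (fun z => Real.log ‖h z‖) 0 R := hcont.circleIntegrable hR.le
  have hciC : CircleIntegrable (fun z => (Real.log ‖h z‖ : ℂ)) 0 R :=
    ContinuousOn.circleIntegrable hR.le (Complex.continuous_ofReal.comp_continuousOn hcont)
  -- `P` is the Herglotz integral of log ‖h‖, analytic with real part log ‖h‖. So h·exp(−P) has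
  -- modulus 1, is constant by the maximum principle, and `logDeriv h` = P', an explicit integral.
  set P : ℂ → ℂ := fun w =>
    circleAverage (fun ζ => herglotzRieszKernel 0 w ζ • (Real.log ‖h ζ‖ : ℂ)) 0 R with hP
  have hPder : ∀ v ∈ ball (0 : ℂ) R, HasDerivAt P
      (circleAverage (fun ζ => (2 * ζ / (ζ - v) ^ 2) • (Real.log ‖h ζ‖ : ℂ)) 0 R) v := fun v hv =>
    hasDerivAt_circleAverage_herglotzRieszKernel_smul hciC hv
  have hPre : ∀ v ∈ ball (0 : ℂ) R, (P v).re = Real.log ‖h v‖ := fun v hv => by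
    rw [hP, re_circleAverage_herglotzRieszKernel_smul hci hv]
    exact hharm.circleAverage_re_herglotzRieszKernel_smul hv
  set g : ℂ → ℂ := fun v => h v * Complex.exp (-P v) with hg
  have hhd : ∀ v ∈ ball (0 : ℂ) R, HasDerivAt h (deriv h v) v := fun v hv =>
    (h₁ v (ball_subset_closedBall hv)).differentiableAt.hasDerivAt
  have hgd : ∀ v ∈ ball (0 : ℂ) R, HasDerivAt g
      (deriv h v * Complex.exp (-P v) + h v * (Complex.exp (-P v) * -(deriv P v))) v :=
    fun v hv => (hhd v hv).mul ((hPder v hv).differentiableAt.hasDerivAt.neg.cexp)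
  have hgn : ∀ v ∈ ball (0 : ℂ) R, ‖g v‖ = 1 := fun v hv => by
    have hne : 0 < ‖h v‖ := by simpa using h₂ v (ball_subset_closedBall hv)
    rw [hg]
    simp only [norm_mul, Complex.norm_exp, Complex.neg_re, hPre v hv, Real.exp_neg,
      Real.exp_log hne]
    field_simp
  have hgconst : EqOn g (Function.const ℂ (g w)) (ball 0 R) := by
    refine Complex.eqOn_of_isPreconnected_of_isMaxOn_norm (convex_ball 0 R).isPreconnected
      isOpen_ball (fun v hv => (hgd v hv).differentiableAt.differentiableWithinAt) hw ?_
    intro v hv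
    simp [hgn v hv, hgn w hw]
  have hg0 : deriv g w = 0 := by
    have : g =ᶠ[𝓝 w] fun _ => g w := eventually_of_mem (isOpen_ball.mem_nhds hw) hgconst
    rw [this.deriv_eq]; simp
  rw [(hgd w hw).deriv] at hg0
  have hlog : logDeriv h w = deriv P w := by
    have hne := h₂ w (ball_subset_closedBall hw)
    have he := Complex.exp_ne_zero (-P w)
    rw [logDeriv_apply, div_eq_iff hne]
    apply mul_right_cancel₀ he
    linear_combination hg0
  rw [hlog, (hPder w hw).deriv]
  have hkey : ∀ θ : ℝ, ‖(2 * circleMap 0 R θ / (circleMap 0 R θ - w) ^ 2) •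
      (Real.log ‖h (circleMap 0 R θ)‖ : ℂ)‖ ≤
      2 * R / (R - ‖w‖) ^ 2 * |Real.log ‖h (circleMap 0 R θ)‖| := by
    intro θ
    rw [norm_smul, norm_div, norm_mul, norm_circleMap_zero, abs_of_pos hR, norm_pow,
      Complex.norm_real, Real.norm_eq_abs]
    have h2 : ‖(2 : ℂ)‖ = 2 := by norm_num
    rw [h2]
    have hd : R - ‖w‖ ≤ ‖circleMap 0 R θ - w‖ := by
      have := norm_sub_norm_le (circleMap 0 R θ) w
      rwa [norm_circleMap_zero, abs_of_pos hR] at this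
    have hpos : 0 < R - ‖w‖ := by linarith
    gcongr
  rw [circleAverage_def, norm_smul, circleAverage_def, smul_eq_mul, mul_left_comm]
  rw [Real.norm_of_nonneg (by positivity), ← intervalIntegral.integral_const_mul]
  gcongr
  refine intervalIntegral.norm_integral_le_of_norm_le two_pi_pos.le
    (Eventually.of_forall fun θ _ => hkey θ) ?_
  exact ((ContinuousOn.circleIntegrable hR.le hcont.abs).const_mul _)


/-! ### Meromorphic functions of logarithmic growth -/

-- If the support were infinite, n > C of its points would already contribute n log r − O(1), which
-- eventually exceeds C log r.
open Function.locallyFinsuppWithin in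
theorem finite_support_of_frequently_logCounting_le {D : Function.locallyFinsupp ℂ ℤ} (h : 0 ≤ D)
    {C : ℝ} (hC : ∃ᶠ r in atTop, Function.locallyFinsuppWithin.logCounting D r ≤ C * Real.log r) :
    D.support.Finite := by
  classical
  obtain ⟨n, hn⟩ := exists_nat_gt C
  by_contra! hInf
  obtain ⟨t, htsub, htcard⟩ := hInf.exists_subset_card_eq n
  set D' := ∑ z ∈ t, single z (1 : ℤ) with hD'
  have hle : D' ≤ D := by
    intro w
    change D' w ≤ D w
    simp only [hD', coe_sum, Finset.sum_apply, single_apply, Finset.sum_ite_eq]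
    by_cases hw : w ∈ t
    · simp only [hw, if_true]
      have h₁ : D w ≠ 0 := Function.mem_support.mp (htsub (Finset.mem_coe.2 hw))
      have h₂ : (0 : ℤ) ≤ D w := by simpa using h w
      lia
    · simpa [hw, if_false] using h w
  obtain ⟨R₀, hR₀⟩ : ∃ R₀ : ℝ, ∀ z ∈ t, ‖z‖ ≤ R₀ := t.finite_toSet.isBounded.exists_norm_le
  set K := ∑ z ∈ t, Real.log ‖z‖ with hK
  have hEq : ∀ r ≥ R₀, Function.locallyFinsuppWithin.logCounting D' r = (n : ℝ) * Real.log r - K := by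
    intro r hr
    calc
      Function.locallyFinsuppWithin.logCounting D' r =
          ∑ c ∈ t, Function.locallyFinsuppWithin.logCounting (single c 1) r := by simp [hD']
       _ = ∑ z ∈ t, (Real.log r - Real.log ‖z‖) := by
        refine Finset.sum_congr rfl fun z hz => ?_
        simpa using logCounting_single_eq_log_sub_const (e := z) (n := 1) ((hR₀ z hz).trans hr)
       _ = (n : ℝ) * Real.log r - K := by simp [Finset.sum_sub_distrib, hK, htcard]
  have hTendsto : Tendsto (fun r ↦ ((n : ℝ) - C) * Real.log r) atTop atTop :=
    tendsto_log_atTop.const_mul_atTop (sub_pos.mpr hn)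
  obtain ⟨r, hr, hr₀, hr₁, hr₂⟩ := (hC.and_eventually ((eventually_ge_atTop R₀).and
    ((eventually_ge_atTop 1).and (hTendsto.eventually_gt_atTop K)))).exists
  have := Function.locallyFinsuppWithin.logCounting_le hle hr₁
  rw [hEq r hr₀] at this
  linarith

/-! ### First main theorem inequalities and criteria for rationality. -/

theorem T_def (r : ℝ) (f : ℂ → ℂ) : T r f = proximity f ⊤ r + ValueDistribution.logCounting f ⊤ r :=
  rfl

theorem proximity_le_T {f : ℂ → ℂ} {r : ℝ} (hr : 1 ≤ r) : proximity f ⊤ r ≤ T r f := by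
  have := ValueDistribution.logCounting_nonneg (f := f) (e := ⊤) hr
  rw [T_def]; linarith

theorem logCounting_le_T {f : ℂ → ℂ} {r : ℝ} :
    ValueDistribution.logCounting f ⊤ r ≤ T r f := by
  have := proximity_nonneg (f := f) (a := ⊤) r
  rw [T_def]; simp only [Pi.zero_apply] at this; linarith

theorem T_nonneg {f : ℂ → ℂ} {r : ℝ} (hr : 1 ≤ r) : 0 ≤ T r f := characteristic_nonneg hr

theorem T_inv_le {f : ℂ → ℂ} (hf : Meromorphic f) {r : ℝ} (hr : r ≠ 0) :
    T r f⁻¹ ≤ T r f + |Real.log ‖meromorphicTrailingCoeffAt f 0‖| := by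
  have := characteristic_sub_characteristic_inv_of_ne_zero hf hr
  have h2 := neg_abs_le (Real.log ‖meromorphicTrailingCoeffAt f 0‖)
  unfold T; linarith

theorem logCounting_zero_le_T {f : ℂ → ℂ} (hf : Meromorphic f) {r : ℝ} (hr : r ≠ 0) :
    ValueDistribution.logCounting f 0 r ≤
      T r f + |Real.log ‖meromorphicTrailingCoeffAt f 0‖| := by
  rw [← logCounting_inv]
  exact logCounting_le_T.trans (T_inv_le hf hr)

theorem circleIntegrable_abs_log_norm {f : ℂ → ℂ} (hf : Meromorphic f) (r : ℝ) :
    CircleIntegrable (fun z => |Real.log ‖f z‖|) 0 r := by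
  have h := hf.meromorphicOn.circleIntegrable_log_norm (c := 0) (R := r)
  exact IntervalIntegrable.abs h

/-- |log x| = log⁺ x + log⁺ (1/x), so the mean is m(r, f) + m(r, 1/f). -/
theorem circleAverage_abs_log_norm_le {f : ℂ → ℂ} (hf : Meromorphic f) {r : ℝ} (hr : 1 ≤ r) :
    circleAverage (fun z => |Real.log ‖f z‖|) 0 r ≤
      2 * T r f + |Real.log ‖meromorphicTrailingCoeffAt f 0‖| := by
  have h : circleAverage (fun z => |Real.log ‖f z‖|) 0 r = proximity f ⊤ r + proximity f⁻¹ ⊤ r := by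
    rw [proximity_top, proximity_top, ← circleAverage_fun_add]
    · congr 1; ext z
      rw [Pi.inv_apply, norm_inv]
      rcases le_total 0 (Real.log ‖f z‖) with h | h
      · rw [abs_of_nonneg h]
        change _ = max 0 (Real.log _) + max 0 (Real.log _)
        rw [Real.log_inv, max_eq_right h,
          max_eq_left (by linarith), add_zero]
      · rw [abs_of_nonpos h]
        change _ = max 0 (Real.log _) + max 0 (Real.log _)
        rw [Real.log_inv, max_eq_left h,
          max_eq_right (by linarith), zero_add]
    · exact hf.meromorphicOn.circleIntegrable_posLog_norm
    · exact hf.inv.meromorphicOn.circleIntegrable_posLog_norm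
  have h1 := proximity_le_T (f := f) hr
  have h2 := proximity_le_T (f := f⁻¹) hr
  have h3 := T_inv_le hf (r := r) (by positivity)
  linarith

/-- Identity theorem: infinite order at one point spreads over the connected plane. -/
theorem eventuallyEq_zero_of_meromorphicOrderAt_eq_top {f : ℂ → ℂ} (hf : Meromorphic f) {z : ℂ}
    (hz : meromorphicOrderAt f z = ⊤) : f =ᶠ[codiscrete ℂ] 0 := by
  have hall : ∀ u, meromorphicOrderAt f u = ⊤ := by
    by_contra! hcon
    exact hf.exists_meromorphicOrderAt_ne_top_iff_forall.1 hcon z hz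
  rw [Filter.EventuallyEq, Filter.Eventually, mem_codiscrete]
  intro x
  rw [disjoint_principal_right, compl_compl]
  exact meromorphicOrderAt_eq_top_iff.1 (hall x)

theorem isRational_of_meromorphicOrderAt_eq_top {f : ℂ → ℂ} (hf : Meromorphic f) {z : ℂ}
    (hz : meromorphicOrderAt f z = ⊤) : IsRational f := by
  refine ⟨0, 1, one_ne_zero, ?_⟩
  filter_upwards [eventuallyEq_zero_of_meromorphicOrderAt_eq_top hf hz] with u hu
  simp [hu]

theorem meromorphicOrderAt_ne_top_of_not_isRational {f : ℂ → ℂ}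
    (hf : IsTranscendentalMeromorphic f) (z : ℂ) : meromorphicOrderAt f z ≠ ⊤ :=
  fun h => hf.not_isRational (isRational_of_meromorphicOrderAt_eq_top hf.meromorphic h)

theorem isRational_of_factorized {f : ℂ → ℂ} {D : ℂ → ℤ} (hD : D.support.Finite) {c : ℂ}
    (h : f =ᶠ[codiscrete ℂ] fun z => (∏ᶠ u, (· - u) ^ D u) z * c) : IsRational f := by
  classical
  refine ⟨Polynomial.C c * ∏ u ∈ hD.toFinset, (Polynomial.X - Polynomial.C u) ^ (D u).toNat,
    ∏ u ∈ hD.toFinset, (Polynomial.X - Polynomial.C u) ^ (-D u).toNat,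
    Finset.prod_ne_zero_iff.2 fun u _ => pow_ne_zero _ (Polynomial.X_sub_C_ne_zero u), ?_⟩
  filter_upwards [h] with z hz
  rw [hz, Function.FactorizedRational.finprod_eq_fun hD]
  beta_reduce
  rw [finprod_eq_prod_of_mulSupport_subset (s := hD.toFinset)]
  · rw [mul_comm, Polynomial.eval_mul, Polynomial.eval_C, Polynomial.eval_prod,
      Polynomial.eval_prod, mul_div_assoc, ← Finset.prod_div_distrib]
    congr 1
    refine Finset.prod_congr rfl fun u _ => ?_
    simp only [Polynomial.eval_pow, Polynomial.eval_sub, Polynomial.eval_X, Polynomial.eval_C]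
    rcases le_total 0 (D u) with h0 | h0
    · lift D u to ℕ using h0 with n
      simp
    · obtain ⟨n, hn⟩ := Int.exists_eq_neg_ofNat h0
      simp [hn]
  · intro u hu
    simp only [Function.mem_mulSupport, ne_eq] at hu
    simp only [Finite.coe_toFinset, Function.mem_support, ne_eq]
    rintro h0
    simp [h0] at hu

/-- A meromorphic function whose characteristic is `O(log r)` along some sequence is rational. -/
theorem isRational_of_frequently_T_le {f : ℂ → ℂ} (hf : Meromorphic f) {C : ℝ}
    (hC : ∃ᶠ r in atTop, T r f ≤ C * Real.log r) : IsRational f := by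
  classical
  by_contra hrat
  have htop := meromorphicOrderAt_ne_top_of_not_isRational ⟨hf, hrat⟩
  set K := |Real.log ‖meromorphicTrailingCoeffAt f 0‖| with hK
  have hK0 : 0 ≤ K := abs_nonneg _
  set D := divisor f univ with hD
  have hneg : (D⁻).support.Finite := by
    refine finite_support_of_frequently_logCounting_le (C := C) (negPart_nonneg _) ?_
    refine hC.mono fun r hr => ?_
    rw [← logCounting_top]
    exact logCounting_le_T.trans hr
  have hpos : (D⁺).support.Finite := by
    refine finite_support_of_frequently_logCounting_le (C := C + K) (posPart_nonneg _) ?_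
    refine (hC.and_eventually (eventually_ge_atTop (Real.exp 1))).mono fun r ⟨hr, hr1⟩ => ?_
    have hr0 : 0 < r := (Real.exp_pos 1).trans_le hr1
    have hl : 1 ≤ Real.log r := by rwa [Real.le_log_iff_exp_le hr0]
    rw [← logCounting_zero]
    have := logCounting_zero_le_T hf hr0.ne'
    nlinarith
  have hfin : D.support.Finite := by
    refine (hpos.union hneg).subset fun u hu => ?_
    by_contra hcon
    simp only [mem_union, Function.mem_support, not_or, not_not] at hcon
    have h1 : D u = D⁺ u - D⁻ u := by
      conv_lhs => rw [← posPart_sub_negPart D]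
      rfl
    rw [hcon.1, hcon.2] at h1
    exact hu (by simpa using h1)
  -- The divisor is finite, so f is a rational function times a zero-free entire g; it remains to
  -- show that g is constant.
  obtain ⟨g, hg1, hg2, hg3⟩ := (meromorphicOn_univ.2 hf).extract_zeros_poles
    (fun u => htop u) hfin
  rw [← hD] at hg3
  have hg2' : ∀ u, g u ≠ 0 := fun u => hg2 ⟨u, mem_univ u⟩
  have hlog := MeromorphicOn.extract_zeros_poles_log hg2 hg3
  have hgm : Meromorphic g := fun z => (hg1 z (mem_univ z)).meromorphicAt
  set m := ∑ u ∈ hfin.toFinset, |(D u : ℝ)| with hm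
  have hm0 : 0 ≤ m := Finset.sum_nonneg fun _ _ => abs_nonneg _
  obtain ⟨R₀, hR₀⟩ : ∃ R₀ : ℝ, ∀ z ∈ hfin.toFinset, ‖z‖ ≤ R₀ :=
    hfin.toFinset.finite_toSet.isBounded.exists_norm_le
  -- For r ≥ R₀ + 1 every zero or pole u satisfies 1 ≤ |z − u| ≤ 2r on the circle, so each linear
  -- factor has logarithm in [0, log 2r].
  have havg : ∀ r, 1 ≤ r → R₀ + 1 ≤ r → circleAverage (fun z => |Real.log ‖g z‖|) 0 r ≤
      2 * T r f + K + m * Real.log (2 * r) := by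
    intro r hr1 hr
    have hr0 : r ≠ 0 := by positivity
    have hsum : circleAverage (fun z => |Real.log ‖g z‖|) 0 r =
        circleAverage (fun z => |Real.log ‖f z‖ -
          ∑ u ∈ hfin.toFinset, D u * Real.log ‖z - u‖|) 0 r := by
      refine circleAverage_congr_codiscreteWithin ?_ hr0
      have h' := hlog.filter_mono (codiscreteWithin_mono (subset_univ (sphere (0 : ℂ) |r|)))
      filter_upwards [h'] with z hz
      rw [hz, Pi.add_apply]
      rw [finsum_eq_sum_of_support_subset (s := hfin.toFinset)]
      · simp
      · intro u hu
        simp only [Finite.coe_toFinset, Function.mem_support] at hu ⊢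
        contrapose! hu
        ext; simp [hu]
    have hb : ∀ z ∈ sphere (0 : ℂ) |r|, |Real.log ‖f z‖ -
        ∑ u ∈ hfin.toFinset, D u * Real.log ‖z - u‖| ≤
        |Real.log ‖f z‖| + m * Real.log (2 * r) := by
      intro z hz
      have hzr : ‖z‖ = r := by simpa [abs_of_pos (show 0 < r by positivity)] using hz
      refine (abs_sub _ _).trans (add_le_add le_rfl ?_)
      rw [hm, Finset.sum_mul]
      refine (Finset.abs_sum_le_sum_abs _ _).trans (Finset.sum_le_sum fun u hu => ?_)
      rw [abs_mul]
      refine mul_le_mul_of_nonneg_left ?_ (abs_nonneg _)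
      have h1 : 1 ≤ ‖z - u‖ := by
        have := norm_sub_norm_le z u
        have := hR₀ u hu
        linarith
      have h2 : ‖z - u‖ ≤ 2 * r := by
        have := norm_sub_le z u
        have := hR₀ u hu
        linarith
      rw [abs_of_nonneg (Real.log_nonneg h1)]
      exact Real.log_le_log (by linarith) h2
    have hci2 : CircleIntegrable (fun z => |Real.log ‖f z‖| + m * Real.log (2 * r)) 0 r :=
      (circleIntegrable_abs_log_norm hf r).add (circleIntegrable_const _ _ _)
    have hci1 : CircleIntegrable (fun z => |Real.log ‖f z‖ -
        ∑ u ∈ hfin.toFinset, D u * Real.log ‖z - u‖|) 0 r := by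
      refine IntervalIntegrable.abs (IntervalIntegrable.sub
        (hf.meromorphicOn.circleIntegrable_log_norm (c := 0) (R := r)) ?_)
      have hs := CircleIntegrable.sum hfin.toFinset (c := 0) (R := r)
        (f := fun u z => D u * Real.log ‖z - u‖) fun u _ => by
          have : Meromorphic fun z : ℂ => z - u := fun z => by fun_prop
          exact IntervalIntegrable.const_mul
            (this.meromorphicOn.circleIntegrable_log_norm (c := 0) (R := r)) _
      rw [Finset.sum_fn] at hs
      exact hs
    rw [hsum]
    calc _ ≤ _ := circleAverage_mono hci1 hci2 hb
      _ = circleAverage (fun z => |Real.log ‖f z‖|) 0 r + m * Real.log (2 * r) := by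
        rw [circleAverage_fun_add (circleIntegrable_abs_log_norm hf r)
          (circleIntegrable_const _ _ _), circleAverage_const]
      _ ≤ _ := by
        have := circleAverage_abs_log_norm_le hf hr1
        linarith
  have hC' : ∃ᶠ r in atTop, circleAverage (fun z => |Real.log ‖g z‖|) 0 r ≤
      (2 * C + K + 2 * m) * Real.log r := by
    refine (hC.and_eventually ((eventually_ge_atTop (Real.exp 1)).and
      ((eventually_ge_atTop (R₀ + 1)).and (eventually_ge_atTop 2)))).mono
      fun r ⟨hr, hr1, hr2, hr3⟩ => ?_
    have hr0 : 0 < r := (Real.exp_pos 1).trans_le hr1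
    have hl : 1 ≤ Real.log r := by rwa [Real.le_log_iff_exp_le hr0]
    have h1 := havg r (by linarith) hr2
    have h2 : Real.log (2 * r) ≤ 2 * Real.log r := by
      rw [Real.log_mul (by norm_num) hr0.ne']
      have := Real.log_le_log (by norm_num) hr3
      linarith
    have h3 := mul_le_mul_of_nonneg_left h2 hm0
    have h4 : K ≤ K * Real.log r := le_mul_of_one_le_right hK0 hl
    nlinarith
  -- The bound for zero-free functions gives |g'/g|(w) = O(log r / r) along the sequence of radii,
  -- which tends to 0.
  have hld : ∀ w, logDeriv g w = 0 := by
    intro w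
    rw [← norm_eq_zero]
    by_contra hne
    have hpos' : 0 < ‖logDeriv g w‖ := lt_of_le_of_ne (norm_nonneg _) (Ne.symm hne)
    have hlim : Tendsto (fun r : ℝ => 8 * (2 * C + K + 2 * m) * (Real.log r / r)) atTop (𝓝 0) := by
      have := (Real.isLittleO_log_id_atTop.tendsto_div_nhds_zero).const_mul
        (8 * (2 * C + K + 2 * m))
      simpa using this
    obtain ⟨r, hr, hr1, hr2, hr3⟩ := (hC'.and_eventually
      ((hlim.eventually_lt_const hpos').and
      ((eventually_ge_atTop (2 * ‖w‖)).and (eventually_ge_atTop 1)))).exists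
    have hw : w ∈ ball (0 : ℂ) r := by
      simp only [mem_ball, dist_zero_right]
      have := norm_nonneg w
      rcases eq_or_lt_of_le this with h | h <;> linarith
    have h1 := norm_logDeriv_le_of_ne_zero (fun x _ => hg1 x (mem_univ x)) (fun u _ => hg2' u) hw
    have h2 : 2 * r / (r - ‖w‖) ^ 2 ≤ 8 / r := by
      have hr4 : r / 2 ≤ r - ‖w‖ := by linarith
      rw [div_le_div_iff₀ (by nlinarith) (by linarith)]
      nlinarith
    have h0 : 0 ≤ circleAverage (fun z => |Real.log ‖g z‖|) 0 r :=
      circleAverage_nonneg_of_nonneg fun _ _ => abs_nonneg _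
    have h3 : ‖logDeriv g w‖ ≤ 8 / r * ((2 * C + K + 2 * m) * Real.log r) :=
      h1.trans (mul_le_mul h2 hr h0 (by positivity))
    have h4 : 8 / r * ((2 * C + K + 2 * m) * Real.log r) =
      8 * (2 * C + K + 2 * m) * (Real.log r / r) := by ring
    linarith
  have hconst : ∀ z, g z = g 0 := fun z =>
    is_const_of_deriv_eq_zero (fun x => (hg1 x (mem_univ x)).differentiableAt)
      (fun x => by
        have := hld x
        rw [logDeriv_apply, div_eq_zero_iff] at this
        exact this.resolve_right (hg2' x)) z 0
  refine hrat (isRational_of_factorized (c := g 0) hfin ?_)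
  filter_upwards [hg3] with z hz
  rw [hz]
  simp [hconst z]

/-- For a transcendental meromorphic function, `log r = o(T(r, f))`. -/
theorem isLittleO_log_T {f : ℂ → ℂ} (hf : IsTranscendentalMeromorphic f) :
    Real.log =o[atTop] fun r => T r f := by
  rw [isLittleO_iff]
  intro c hc
  by_contra hcon
  refine hf.not_isRational (isRational_of_frequently_T_le hf.meromorphic (C := c⁻¹) ?_)
  rw [not_eventually] at hcon
  refine (hcon.and_eventually (eventually_ge_atTop 1)).mono fun r ⟨hr, hr1⟩ => ?_
  rw [not_le, Real.norm_of_nonneg (Real.log_nonneg hr1), Real.norm_of_nonneg (T_nonneg hr1)] at hr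
  rw [inv_mul_eq_div, le_div_iff₀ hc]
  linarith

/-! ### The logarithmic derivative in terms of zeros, poles and boundary values -/

/-- The factor is (R² − ūz)/(R(z − u)). Its numerator has modulus at least R(R − r) on |z| = r,
which gives the first term; the pole at u gives the second. -/
theorem norm_logDeriv_canonicalFactor_le {R r : ℝ} {u z : ℂ} (hu : u ∈ ball (0 : ℂ) R)
    (hz : ‖z‖ = r) (hr : r < R) (hzu : z ≠ u) :
    ‖logDeriv (Complex.canonicalFactor R u) z‖ ≤ 1 / (R - r) + ‖z - u‖⁻¹ := by
  have hR : 0 < R := pos_of_mem_ball hu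
  have huR : ‖u‖ < R := by simpa using hu
  have hsub : z - u ≠ 0 := sub_ne_zero.2 hzu
  have hRC : (R : ℂ) ≠ 0 := by exact_mod_cast hR.ne'
  have hlow : R * (R - r) ≤ ‖(R : ℂ) ^ 2 - (starRingEnd ℂ) u * z‖ := by
    have h1 := norm_sub_norm_le ((R : ℂ) ^ 2) ((starRingEnd ℂ) u * z)
    have h2 : ‖(R : ℂ) ^ 2‖ = R ^ 2 := by simp
    have h3 : ‖(starRingEnd ℂ) u * z‖ ≤ R * r := by
      rw [norm_mul, RCLike.norm_conj, hz]
      exact mul_le_mul_of_nonneg_right huR.le (hz ▸ norm_nonneg z)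
    rw [h2] at h1
    nlinarith
  have hnum0 : 0 < ‖(R : ℂ) ^ 2 - (starRingEnd ℂ) u * z‖ :=
    lt_of_lt_of_le (mul_pos hR (by linarith)) hlow
  have hnum : (R : ℂ) ^ 2 - (starRingEnd ℂ) u * z ≠ 0 := norm_pos_iff.1 hnum0
  have e1 : HasDerivAt (fun z : ℂ => (R : ℂ) ^ 2 - (starRingEnd ℂ) u * z)
      (-(starRingEnd ℂ) u) z := by
    simpa using ((hasDerivAt_id z).const_mul ((starRingEnd ℂ) u)).const_sub ((R : ℂ) ^ 2)
  have e2 : HasDerivAt (fun z : ℂ => (R : ℂ) * (z - u)) (R : ℂ) z := by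
    simpa using ((hasDerivAt_id z).sub_const u).const_mul (R : ℂ)
  have heq : logDeriv (Complex.canonicalFactor R u) z =
      -(starRingEnd ℂ) u / ((R : ℂ) ^ 2 - (starRingEnd ℂ) u * z) - (z - u)⁻¹ := by
    rw [Complex.canonicalFactor_def, logDeriv_apply]
    have e3 := (e1.fun_div e2 (mul_ne_zero hRC hsub)).deriv
    rw [e3]
    field_simp
  rw [heq]
  refine (norm_sub_le _ _).trans (add_le_add ?_ (by rw [norm_inv]))
  rw [norm_div, norm_neg, RCLike.norm_conj, div_le_div_iff₀ hnum0 (by linarith)]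
  nlinarith [norm_nonneg u]

/-- The differentiated Poisson–Jensen formula, as an inequality. -/
theorem norm_logDeriv_le {f : ℂ → ℂ} (hf : Meromorphic f) (hftop : ∀ z, meromorphicOrderAt f z ≠ ⊤)
    {r R : ℝ} (hr : 0 ≤ r) (hrR : r < R) (hsph : ∀ z ∈ sphere (0 : ℂ) R, meromorphicOrderAt f z = 0)
    {S : Finset ℂ} (hS : (divisor f (ball 0 R)).support ⊆ S) :
    ∀ᶠ z in codiscreteWithin (sphere (0 : ℂ) r), ‖logDeriv f z‖ ≤
      (2 * R / (R - r) ^ 2 * circleAverage (fun z => |Real.log ‖f z‖|) 0 R +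
        (∑ u ∈ S, |(divisor f (ball 0 R) u : ℝ)|) / (R - r)) +
      ∑ u ∈ S, |(divisor f (ball 0 R) u : ℝ)| * ‖z - u‖⁻¹ := by
  classical
  have hR : 0 < R := hr.trans_lt hrR
  -- Canonical factors carry the zeros and poles in the open disc and are unimodular on |z| = R. No
  -- zeros or poles lie on that circle, so |f| and the zero-free cofactor |h| have the same boundary
  -- values off a discrete set.
  obtain ⟨h, hh⟩ := (hf.meromorphicOn (s := closedBall 0 R)).exists_ecanonicalDecomp
    (fun u => hftop u)
  set D := divisor f (ball 0 R) with hD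
  have hDsph : ∀ v, divisor f (sphere 0 R) v = 0 := by
    intro v
    by_cases hv : v ∈ sphere (0 : ℂ) R
    · rw [divisor_apply hf.meromorphicOn hv, hsph v hv]; rfl
    · exact Function.locallyFinsuppWithin.apply_eq_zero_of_notMem _ hv
  have hprod : (∏ᶠ u, (Complex.canonicalFactor R u) ^ (-D u)) =
      ∏ u ∈ S, (Complex.canonicalFactor R u) ^ (-D u) := by
    refine finprod_eq_prod_of_mulSupport_subset _ fun u hu => hS ?_
    simp only [Function.mem_mulSupport, Function.mem_support] at hu ⊢
    rintro h0; simp [h0] at hu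
  have hev : f =ᶠ[codiscreteWithin (closedBall 0 R)]
      fun z => (∏ u ∈ S, (Complex.canonicalFactor R u z) ^ (-D u)) * h z := by
    filter_upwards [hh.eventuallyEq] with z hz
    rw [hz, hprod]
    simp [hDsph]
  have hDne : ∀ {u}, D u ≠ 0 → u ∈ ball (0 : ℂ) R := fun {u} hu => by
    by_contra hcon
    exact hu (Function.locallyFinsuppWithin.apply_eq_zero_of_notMem _ hcon)
  have havg : circleAverage (fun z => |Real.log ‖f z‖|) 0 R =
      circleAverage (fun z => |Real.log ‖h z‖|) 0 R := by
    refine circleAverage_congr_codiscreteWithin ?_ hR.ne'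
    rw [abs_of_pos hR]
    filter_upwards [hev.filter_mono (codiscreteWithin_mono sphere_subset_closedBall),
      self_mem_codiscreteWithin (sphere (0 : ℂ) R)] with z hz hzs
    rw [hz, norm_mul, norm_prod, Finset.prod_eq_one, one_mul]
    intro u _
    by_cases hu : D u = 0
    · simp [hu]
    · rw [norm_zpow, Complex.norm_canonicalFactor_eval_circle_eq_one (hDne hu) hzs, one_zpow]
  have hld := logDeriv_congr_codiscreteWithin isOpen_ball
    (hev.filter_mono (codiscreteWithin_mono ball_subset_closedBall))
  have hsb : sphere (0 : ℂ) r ⊆ ball 0 R := fun z hz => by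
    simp only [mem_sphere, mem_ball] at hz ⊢; linarith
  have hSc : (S : Set ℂ)ᶜ ∈ codiscreteWithin (sphere (0 : ℂ) r) :=
    codiscreteWithin_mono (subset_univ _) S.finite_toSet.compl_mem_codiscrete
  filter_upwards [hld.filter_mono (codiscreteWithin_mono hsb), hSc,
    self_mem_codiscreteWithin (sphere (0 : ℂ) r)] with z hz hzS hzr
  have hzr' : ‖z‖ = r := by simpa using hzr
  have hzB : z ∈ ball (0 : ℂ) R := hsb hzr
  have hzcB : z ∈ closedBall (0 : ℂ) R := ball_subset_closedBall hzB
  have hzu : ∀ u ∈ S, z ≠ u := fun u hu he => hzS (by simpa [he] using hu)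
  have hfac : ∀ u ∈ S, (Complex.canonicalFactor R u z) ^ (-D u) ≠ 0 := fun u hu => by
    by_cases h0 : D u = 0
    · simp [h0]
    · exact zpow_ne_zero _ (Complex.canonicalFactor_ne_zero (hDne h0) hzcB (hzu u hu))
  have hdiff : ∀ u ∈ S, DifferentiableAt ℂ (Complex.canonicalFactor R u) z := fun u hu =>
    (Complex.analyticOnNhd_canonicalFactor R u z (hzu u hu)).differentiableAt
  have hdiffz : ∀ u ∈ S, DifferentiableAt ℂ
      (fun z => (Complex.canonicalFactor R u z) ^ (-D u)) z := fun u hu => by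
    by_cases h0 : D u = 0
    · simp [h0]
    · exact (hdiff u hu).zpow
        (Or.inl (Complex.canonicalFactor_ne_zero (hDne h0) hzcB (hzu u hu)))
  rw [hz, logDeriv_mul z (Finset.prod_ne_zero_iff.2 hfac) (hh.ne_zero z hzcB)
    (DifferentiableAt.fun_finsetProd hdiffz)
    (hh.analyticOnNhd z hzcB).differentiableAt, logDeriv_prod (f := fun u z => (Complex.canonicalFactor R u z) ^ (-D u)) hfac hdiffz]
  refine (norm_add_le _ _).trans ?_
  have h1 := norm_logDeriv_le_of_ne_zero hh.analyticOnNhd hh.ne_zero hzB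
  rw [hzr', ← havg] at h1
  have h2 : ‖∑ u ∈ S, logDeriv (fun z => (Complex.canonicalFactor R u z) ^ (-D u)) z‖ ≤
      (∑ u ∈ S, |(D u : ℝ)|) / (R - r) + ∑ u ∈ S, |(D u : ℝ)| * ‖z - u‖⁻¹ := by
    rw [Finset.sum_div, ← Finset.sum_add_distrib]
    refine norm_sum_le_of_le _ fun u hu => ?_
    by_cases h0 : D u = 0
    · simp [h0, logDeriv_apply]
    · rw [logDeriv_fun_zpow (hdiff u hu), norm_mul]
      have h3 := norm_logDeriv_canonicalFactor_le (hDne h0) hzr' hrR (hzu u hu)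
      have h4 : ‖((-D u : ℤ) : ℂ)‖ = |(D u : ℝ)| := by
        rw [Complex.norm_intCast]; push_cast; rw [abs_neg]
      rw [h4]
      refine (mul_le_mul_of_nonneg_left h3 (abs_nonneg _)).trans (le_of_eq ?_)
      ring
  linarith

/-! ### Circle means -/

theorem mul_div_pi_le_norm_circleMap_sub {r t : ℝ} (hr : 0 ≤ r) (ht : 0 ≤ t) (htπ : t ≤ π)
    (u : ℂ) {ε : ℝ} (hε : ε = 1 ∨ ε = -1) :
    r * (t / π) ≤ ‖circleMap 0 r (u.arg + ε * t) - u‖ := by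
  have hpi := Real.pi_pos
  refine le_of_sq_le_sq ?_ (norm_nonneg _)
  have hcos : Real.cos (ε * t) = Real.cos t := by rcases hε with rfl | rfl <;> simp
  have hn : ‖circleMap 0 r (u.arg + ε * t) - u‖ ^ 2 =
      r ^ 2 + ‖u‖ ^ 2 - 2 * r * ‖u‖ * Real.cos t := by
    have hu : u = ‖u‖ * Complex.exp (u.arg * Complex.I) := (Complex.norm_mul_exp_arg_mul_I u).symm
    have : circleMap 0 r (u.arg + ε * t) - u =
        Complex.exp (u.arg * Complex.I) * (r * Complex.exp ((ε * t : ℝ) * Complex.I) - ‖u‖) := by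
      rw [circleMap]
      push_cast
      rw [add_mul, Complex.exp_add]
      linear_combination -hu
    rw [this, norm_mul, Complex.norm_exp_ofReal_mul_I, one_mul, ← hcos, ← Complex.normSq_eq_norm_sq,
      Complex.normSq_apply, Complex.exp_mul_I]
    simp only [Complex.sub_re, Complex.mul_re, Complex.add_re, Complex.sub_im, Complex.mul_im,
      Complex.add_im, Complex.ofReal_re, Complex.ofReal_im, Complex.I_re, Complex.I_im,
      ← Complex.ofReal_cos, ← Complex.ofReal_sin]
    have := Real.sin_sq_add_cos_sq (ε * t)
    linear_combination r ^ 2 * this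
  rw [hn]
  have hu0 := norm_nonneg u
  have ht1 : t / π ≤ 1 := (div_le_one hpi).2 htπ
  have ht0 : 0 ≤ t / π := by positivity
  -- For t ≤ π/2 the squared distance is (‖u‖ − r cos t)² + r² sin² t, and sin t ≥ 2t/π. Beyond π/2
  -- the cosine is nonpositive, so the squared distance is at least r².
  rcases le_total t (π / 2) with h | h
  · have h1 := Real.mul_le_sin ht h
    have h2 : t / π ≤ Real.sin t := by
      refine le_trans ?_ h1
      rw [div_eq_inv_mul, div_eq_mul_inv]
      have : 0 ≤ π⁻¹ * t := by positivity
      linarith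
    have h3 := Real.sin_sq_add_cos_sq t
    have h4 : (t / π) ^ 2 ≤ Real.sin t ^ 2 := pow_le_pow_left₀ ht0 h2 2
    have h5 := sq_nonneg (‖u‖ - r * Real.cos t)
    nlinarith [mul_le_mul_of_nonneg_left h4 (sq_nonneg r)]
  · have h1 : Real.cos t ≤ 0 := Real.cos_nonpos_of_pi_div_two_le_of_le h (by linarith)
    have h4 : (t / π) ^ 2 ≤ 1 := pow_le_one₀ ht0 ht1
    nlinarith [mul_le_mul_of_nonneg_left h4 (sq_nonneg r), mul_nonneg hr hu0]


/-- Means of `‖z - u‖ ^ (-1 / 2)` over circles are bounded uniformly in `u`. -/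
theorem circleAverage_inv_sqrt_norm_sub_le {r : ℝ} (hr : 0 < r) (u : ℂ) :
    CircleIntegrable (fun z => (√‖z - u‖)⁻¹) 0 r ∧
      circleAverage (fun z => (√‖z - u‖)⁻¹) 0 r ≤ 2 / √r := by
  have hpi := Real.pi_pos
  set α := u.arg with hα
  set F : ℝ → ℝ := fun θ => (√‖circleMap 0 r θ - u‖)⁻¹ with hF
  have hF0 : ∀ θ, 0 ≤ F θ := fun θ => inv_nonneg.2 (Real.sqrt_nonneg _)
  have hFm : Measurable F := by
    have : Continuous fun θ => ‖circleMap 0 r θ - u‖ :=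
      ((continuous_circleMap 0 r).sub continuous_const).norm
    exact (this.measurable.sqrt).inv
  have hper : Function.Periodic F (2 * π) := fun θ => by
    simp only [hF, periodic_circleMap 0 r θ]
  have hhalf : ∀ ε : ℝ, (ε = 1 ∨ ε = -1) →
      IntervalIntegrable (fun t => F (α + ε * t)) MeasureTheory.volume 0 π ∧
        ∫ t in (0 : ℝ)..π, F (α + ε * t) ≤ 2 * π / √r := by
    intro ε hε
    have hg : IntervalIntegrable (fun t : ℝ => √(π / r) * t ^ (-(1 / 2) : ℝ))
        MeasureTheory.volume 0 π :=
      (intervalIntegral.intervalIntegrable_rpow' (by norm_num)).const_mul _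
    have hb : ∀ t ∈ Ioc 0 π, F (α + ε * t) ≤ √(π / r) * t ^ (-(1 / 2) : ℝ) := by
      intro t ht
      have h1 := mul_div_pi_le_norm_circleMap_sub hr.le ht.1.le ht.2 u hε
      have h2 : 0 < r * (t / π) := mul_pos hr (div_pos ht.1 hpi)
      calc F (α + ε * t) ≤ (√(r * (t / π)))⁻¹ :=
            inv_anti₀ (Real.sqrt_pos.2 h2) (Real.sqrt_le_sqrt h1)
        _ = √(π / r) * t ^ (-(1 / 2) : ℝ) := by
          rw [Real.rpow_neg ht.1.le, ← Real.sqrt_eq_rpow, ← Real.sqrt_inv, ← Real.sqrt_inv,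
            ← Real.sqrt_mul (by positivity)]
          congr 1
          have := ht.1.ne'
          field_simp
    have hi : IntervalIntegrable (fun t => F (α + ε * t)) MeasureTheory.volume 0 π := by
      refine hg.mono_fun ?_ ?_
      · exact (hFm.comp (by fun_prop)).aestronglyMeasurable
      · refine (MeasureTheory.ae_restrict_iff' measurableSet_uIoc).2 (Eventually.of_forall ?_)
        intro t ht
        rw [uIoc_of_le hpi.le] at ht
        beta_reduce
        rw [Real.norm_of_nonneg (hF0 _)]
        exact (hb t ht).trans (le_abs_self _)
    refine ⟨hi, ?_⟩
    calc ∫ t in (0 : ℝ)..π, F (α + ε * t)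
        ≤ ∫ t in (0 : ℝ)..π, √(π / r) * t ^ (-(1 / 2) : ℝ) :=
          intervalIntegral.integral_mono_on_of_le_Ioo hpi.le hi hg
            fun t ht => hb t ⟨ht.1, ht.2.le⟩
      _ = 2 * π / √r := by
        rw [intervalIntegral.integral_const_mul, integral_rpow (Or.inl (by norm_num))]
        have h3 : (-(1 / 2) + 1 : ℝ) = 1 / 2 := by norm_num
        rw [h3, ← Real.sqrt_eq_rpow, Real.zero_rpow (by norm_num), Real.sqrt_div hpi.le]
        have h4 := Real.mul_self_sqrt hpi.le
        field_simp
        linear_combination h4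
  obtain ⟨i1, b1⟩ := hhalf 1 (Or.inl rfl)
  obtain ⟨i2, b2⟩ := hhalf (-1) (Or.inr rfl)
  have j1 : IntervalIntegrable F MeasureTheory.volume α (α + π) := by
    have := i1.comp_sub_right α
    simp only [one_mul, add_sub_cancel, zero_add] at this
    rwa [add_comm π α] at this
  have j2 : IntervalIntegrable F MeasureTheory.volume (α - π) α := by
    have := (i2.comp_sub_left α).symm
    simpa using this
  have e1 : ∫ θ in α..α + π, F θ = ∫ t in (0 : ℝ)..π, F (α + 1 * t) := by
    simp only [one_mul]
    rw [intervalIntegral.integral_comp_add_left F α, add_zero]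
  have e2 : ∫ θ in (α - π)..α, F θ = ∫ t in (0 : ℝ)..π, F (α + -1 * t) := by
    simp only [neg_one_mul, ← sub_eq_add_neg]
    rw [intervalIntegral.integral_comp_sub_left F α, sub_zero]
  -- By periodicity the integral is taken over the period centred at arg u, whose two halves have
  -- just been bounded.
  have hend : α - π + 2 * π = α + π := by ring
  have hint : IntervalIntegrable F MeasureTheory.volume 0 (2 * π) :=
    hper.intervalIntegrable two_pi_pos.ne' (t := α - π) (by rw [hend]; exact j2.trans j1) _ _
  refine ⟨hint, ?_⟩
  have htot : ∫ θ in (0 : ℝ)..2 * π, F θ ≤ 4 * π / √r := by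
    have h5 := hper.intervalIntegral_add_eq 0 (α - π)
    rw [zero_add, hend] at h5
    rw [h5, ← intervalIntegral.integral_add_adjacent_intervals j2 j1, e1, e2]
    calc _ ≤ _ := add_le_add b2 b1
      _ = _ := by ring
  rw [circleAverage_def, smul_eq_mul]
  calc (2 * π)⁻¹ * ∫ θ in (0 : ℝ)..2 * π, F θ ≤ (2 * π)⁻¹ * (4 * π / √r) := by gcongr
    _ = 2 / √r := by field_simp; norm_num

/-- A concavity estimate for the proximity function. -/
theorem proximity_le_two_mul_log {g : ℂ → ℂ} (hg : Meromorphic g) {X : ℂ → ℝ} {r A : ℝ}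
    (hr : r ≠ 0) (hX : CircleIntegrable X 0 r) (hA : circleAverage X 0 r ≤ A) (hA0 : 0 ≤ A)
    (h : ∀ᶠ z in codiscreteWithin (sphere (0 : ℂ) |r|), √‖g z‖ ≤ X z) :
    proximity g ⊤ r ≤ 2 * Real.log (1 + A) := by
  -- `X` dominates √‖g‖ only off a discrete set; `Y` dominates it everywhere and has the same mean.
  set Y : ℂ → ℝ := fun z => max (X z) (√‖g z‖) with hY
  have hXY : X =ᶠ[codiscreteWithin (sphere (0 : ℂ) |r|)] Y := by
    filter_upwards [h] with z hz
    rw [hY]; exact (max_eq_left hz).symm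
  have hYi : CircleIntegrable Y 0 r := hX.congr_codiscreteWithin hXY
  have hYA : circleAverage Y 0 r ≤ A := by rwa [← circleAverage_congr_codiscreteWithin hXY hr]
  have hA1 : 0 < 1 + A := by linarith
  -- Jensen's inequality via a tangent line: log⁺ ‖g‖ ≤ 2 log(1 + Y), and the concave log(1 + y)
  -- lies below its tangent at y = A.
  have hpt : ∀ z ∈ sphere (0 : ℂ) |r|, log⁺ ‖g z‖ ≤
      2 * (Real.log (1 + A) - A / (1 + A)) + (2 / (1 + A)) * Y z := by
    intro z _
    have hs : √‖g z‖ ≤ Y z := le_max_right _ _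
    have hs0 := Real.sqrt_nonneg ‖g z‖
    have h1 : Real.log ((1 + Y z) / (1 + A)) ≤ (1 + Y z) / (1 + A) - 1 :=
      Real.log_le_sub_one_of_pos (div_pos (by linarith) hA1)
    rw [Real.log_div (by linarith) hA1.ne'] at h1
    have h2 : log⁺ ‖g z‖ ≤ 2 * Real.log (1 + Y z) := by
      refine max_le ?_ ?_
      · have := Real.log_nonneg (show 1 ≤ 1 + Y z by linarith)
        linarith
      · rcases eq_or_lt_of_le hs0 with h0 | h0
        · have h3 : ‖g z‖ = 0 := by
            have := (Real.sqrt_eq_zero (norm_nonneg (g z))).1 h0.symm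
            exact this
          have := Real.log_nonneg (show 1 ≤ 1 + Y z by linarith)
          rw [h3, Real.log_zero]; linarith
        · have h3 : Real.log ‖g z‖ = 2 * Real.log √‖g z‖ := by
            rw [Real.log_sqrt (norm_nonneg _)]; ring
          rw [h3]
          have := Real.log_le_log h0 (show √‖g z‖ ≤ 1 + Y z by linarith)
          linarith
    have h4 : (1 + Y z) / (1 + A) - 1 = (1 / (1 + A)) * Y z - A / (1 + A) := by
      field_simp; ring
    have h5 : (2 / (1 + A)) * Y z = 2 * ((1 / (1 + A)) * Y z) := by ring
    linarith
  have hci : CircleIntegrable (fun z => (2 / (1 + A)) * Y z) 0 r :=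
    IntervalIntegrable.const_mul hYi _
  rw [proximity_top]
  calc circleAverage (log⁺ ‖g ·‖) 0 r ≤ circleAverage (fun z =>
        2 * (Real.log (1 + A) - A / (1 + A)) + (2 / (1 + A)) * Y z) 0 r :=
        circleAverage_mono hg.meromorphicOn.circleIntegrable_posLog_norm
          ((circleIntegrable_const _ _ _).add hci) hpt
    _ = 2 * (Real.log (1 + A) - A / (1 + A)) + (2 / (1 + A)) * circleAverage Y 0 r := by
        rw [circleAverage_fun_add (circleIntegrable_const _ _ _) hci, circleAverage_const]
        congr 1
        have := circleAverage_fun_smul (a := (2 / (1 + A))) (f := Y) (c := 0) (R := r)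
        simpa only [smul_eq_mul] using this
    _ ≤ 2 * (Real.log (1 + A) - A / (1 + A)) + (2 / (1 + A)) * A := by gcongr
    _ = 2 * Real.log (1 + A) := by ring

theorem sqrt_add_sum_le {ι : Type*} (S : Finset ι) (b : ι → ℝ) {a : ℝ} (ha : 0 ≤ a)
    (hb : ∀ i ∈ S, 0 ≤ b i) : √(a + ∑ i ∈ S, b i) ≤ √a + ∑ i ∈ S, √(b i) := by
  classical
  induction S using Finset.induction_on with
  | empty => simp
  | insert i S hi ih =>
    have h1 := ih fun j hj => hb j (Finset.mem_insert_of_mem hj)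
    have hS : 0 ≤ a + ∑ i ∈ S, b i :=
      add_nonneg ha (Finset.sum_nonneg fun j hj => hb j (Finset.mem_insert_of_mem hj))
    have hbi := hb i (Finset.mem_insert_self i S)
    have h2 : √((a + ∑ i ∈ S, b i) + b i) ≤ √(a + ∑ i ∈ S, b i) + √(b i) := by
      rw [Real.sqrt_le_left (by positivity)]
      nlinarith [Real.sq_sqrt hS, Real.sq_sqrt hbi, Real.sqrt_nonneg (a + ∑ i ∈ S, b i),
        Real.sqrt_nonneg (b i), mul_nonneg (Real.sqrt_nonneg (a + ∑ i ∈ S, b i))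
        (Real.sqrt_nonneg (b i))]
    rw [Finset.sum_insert hi, Finset.sum_insert hi, add_comm (b i), ← add_assoc]
    linarith

/-- The number of zeros and poles in a disc is bounded by the characteristic on a larger disc. -/
theorem sum_abs_divisor_le {f : ℂ → ℂ} (hf : Meromorphic f) {R R' : ℝ} (hR : 1 ≤ R) (hRR : R < R')
    (S : Finset ℂ) :
    ∑ u ∈ S, |(divisor f (ball 0 R) u : ℝ)| ≤
      (2 * T R' f + |Real.log ‖meromorphicTrailingCoeffAt f 0‖|) * (R' / (R' - R)) := by
  classical
  set D := divisor f (ball 0 R) with hD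
  set E := (divisor f univ)⁺ + (divisor f univ)⁻ with hE
  have hDE : ∀ u, |D u| ≤ E u := by
    intro u
    have hEu : E u = |divisor f univ u| := by
      have h1 : E u = (divisor f univ)⁺ u + (divisor f univ)⁻ u := rfl
      rw [h1, Function.locallyFinsuppWithin.posPart_apply,
        Function.locallyFinsuppWithin.negPart_apply, posPart_add_negPart]
    rw [hEu]
    by_cases hu : u ∈ ball (0 : ℂ) R
    · rw [hD, divisor_apply hf.meromorphicOn hu, divisor_apply hf.meromorphicOn (mem_univ u)]
    · rw [hD, Function.locallyFinsuppWithin.apply_eq_zero_of_notMem _ hu]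
      simp
  set D' : Function.locallyFinsupp ℂ ℤ :=
    ∑ u ∈ S, Function.locallyFinsuppWithin.single u (|D u|) with hD'
  have hle : D' ≤ E := by
    intro w
    change D' w ≤ E w
    simp only [hD', Function.locallyFinsuppWithin.coe_sum, Finset.sum_apply,
      Function.locallyFinsuppWithin.single_apply, Finset.sum_ite_eq]
    by_cases hw : w ∈ S
    · simpa [hw] using hDE w
    · simpa [hw] using (abs_nonneg _).trans (hDE w)
  have hR'1 : 1 ≤ R' := by linarith
  have h1 := Function.locallyFinsuppWithin.logCounting_le hle hR'1
  have h2 : Function.locallyFinsuppWithin.logCounting E R' ≤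
      2 * T R' f + |Real.log ‖meromorphicTrailingCoeffAt f 0‖| := by
    rw [hE, map_add, Pi.add_apply, ← logCounting_zero, ← logCounting_top]
    have := logCounting_zero_le_T hf (r := R') (by positivity)
    have := logCounting_le_T (f := f) (r := R')
    linarith
  -- Each point of the disc of radius R is counted with weight log R' − log ‖u‖ ≥ log R' − log R. At
  -- u = 0 the convention `Real.log 0 = 0` makes the weight log R', and R ≥ 1 suffices.
  have h3 : (∑ u ∈ S, |(D u : ℝ)|) * (Real.log R' - Real.log R) ≤
      Function.locallyFinsuppWithin.logCounting D' R' := by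
    rw [hD', map_sum, Finset.sum_apply, Finset.sum_mul]
    refine Finset.sum_le_sum fun u _ => ?_
    by_cases hu : u ∈ ball (0 : ℂ) R
    · have hu' : ‖u‖ < R := by simpa using hu
      rw [Function.locallyFinsuppWithin.logCounting_single_eq_log_sub_const (by linarith)]
      push_cast
      refine mul_le_mul_of_nonneg_left (sub_le_sub_left ?_ _) (abs_nonneg _)
      rcases eq_or_ne u 0 with rfl | h0
      · simpa using Real.log_nonneg hR
      · exact Real.log_le_log (norm_pos_iff.2 h0) hu'.le
    · rw [hD, Function.locallyFinsuppWithin.apply_eq_zero_of_notMem _ hu]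
      have h0 := congrFun (map_zero (Function.locallyFinsuppWithin.logCounting (E := ℂ))) R'
      simp only [abs_zero, Int.cast_zero, zero_mul, Function.locallyFinsuppWithin.single_zero]
      exact h0.symm.le
  have h4 : 1 - R / R' ≤ Real.log R' - Real.log R := by
    have := Real.one_sub_inv_le_log_of_pos (show 0 < R' / R by positivity)
    rwa [inv_div, Real.log_div (by positivity) (by positivity)] at this
  have h5 : 1 - R / R' = (R' - R) / R' := by field_simp
  rw [h5] at h4
  have h6 : 0 < (R' - R) / R' := div_pos (by linarith) (by linarith)
  have h7 : (∑ u ∈ S, |(D u : ℝ)|) * ((R' - R) / R') ≤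
      2 * T R' f + |Real.log ‖meromorphicTrailingCoeffAt f 0‖| :=
    (mul_le_mul_of_nonneg_left h4 (Finset.sum_nonneg fun _ _ => abs_nonneg _)).trans
      (h3.trans (h1.trans h2))
  rw [← le_div_iff₀ h6] at h7
  rwa [div_div_eq_mul_div, ← mul_div_assoc'] at h7

/-! ### The lemma on the logarithmic derivative -/

/-- A closed disc contains finitely many zeros and poles, so only finitely many radii are excluded.
-/
theorem exists_radius_order_eq_zero {f : ℂ → ℂ} (hf : Meromorphic f)
    (hftop : ∀ z, meromorphicOrderAt f z ≠ ⊤) {a b : ℝ} (hab : a < b) :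
    ∃ R ∈ Ioo a b, ∀ z ∈ sphere (0 : ℂ) R, meromorphicOrderAt f z = 0 := by
  have hfin := (divisor f (closedBall (0 : ℂ) b)).finiteSupport (isCompact_closedBall 0 b)
  obtain ⟨R, hR, hRn⟩ := (Ioo_infinite hab).exists_notMem_finite (hfin.image norm)
  refine ⟨R, hR, fun z hz => ?_⟩
  have hzR : ‖z‖ = R := by simpa using hz
  have hzb : z ∈ closedBall (0 : ℂ) b := by simpa [hzR] using hR.2.le
  by_contra hne
  refine hRn ⟨z, ?_, hzR⟩
  rw [Function.mem_support, divisor_apply hf.meromorphicOn hzb]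
  intro h0
  rw [WithTop.untop₀_eq_zero] at h0
  exact h0.elim hne (hftop z)

theorem proximity_logDeriv_le {f : ℂ → ℂ} (hf : Meromorphic f)
    (hftop : ∀ z, meromorphicOrderAt f z ≠ ⊤) {r δ : ℝ} (hr : 1 ≤ r) (hδ : 0 < δ) (hδ1 : δ ≤ 1) :
    proximity (logDeriv f) ⊤ r ≤ 2 * Real.log (21 *
      (2 * T (r + δ) f + |Real.log ‖meromorphicTrailingCoeffAt f 0‖| + 1) * r / δ) := by
  classical
  set K := |Real.log ‖meromorphicTrailingCoeffAt f 0‖| with hK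
  have hK0 : 0 ≤ K := abs_nonneg _
  set B := 2 * T (r + δ) f + K + 1 with hB
  have hT0 : 0 ≤ T (r + δ) f := T_nonneg (by linarith)
  have hB1 : 1 ≤ B := by linarith
  -- Taking R in the middle third leaves a gap of at least δ/3 on each side: one for the kernel on
  -- |z| = R, one for counting zeros and poles by T(r + δ, f).
  obtain ⟨R, hR, hsph⟩ := exists_radius_order_eq_zero hf hftop
    (show r + δ / 3 < r + 2 * δ / 3 by linarith)
  have hrR : r < R := by linarith [hR.1]
  have hRr : δ / 3 ≤ R - r := by linarith [hR.1]
  have hR' : δ / 3 ≤ r + δ - R := by linarith [hR.2]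
  have hR1 : 1 ≤ R := by linarith
  have hR2 : R ≤ 2 * r := by linarith [hR.2]
  set D := divisor f (ball 0 R) with hD
  have hfin : D.support.Finite := hf.meromorphicOn.divisor_ball_support_finite
  set n := ∑ u ∈ hfin.toFinset, |(D u : ℝ)| with hn
  have hn0 : 0 ≤ n := Finset.sum_nonneg fun _ _ => abs_nonneg _
  set c := circleAverage (fun z => |Real.log ‖f z‖|) 0 R with hc
  have hc0 : 0 ≤ c := circleAverage_nonneg_of_nonneg fun _ _ => abs_nonneg _
  have hcB : c ≤ B := by
    have h1 := circleAverage_abs_log_norm_le hf hR1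
    have h2 : T R f ≤ T (r + δ) f :=
      characteristic_monotoneOn hf (by simp; linarith) (by simp; linarith) (by linarith)
    linarith
  have hnB : n ≤ 6 * B * r / δ := by
    have h1 := sum_abs_divisor_le hf hR1 (show R < r + δ by linarith) hfin.toFinset
    have h2 : (r + δ) / (r + δ - R) ≤ 6 * r / δ := by
      rw [div_le_div_iff₀ (by linarith) hδ]
      nlinarith
    calc n ≤ _ := h1
      _ ≤ B * (6 * r / δ) := by
        refine mul_le_mul (by linarith) h2 ?_ (by linarith)
        exact div_nonneg (by linarith) (by linarith)
      _ = _ := by ring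
  set K₁ := 2 * R / (R - r) ^ 2 * c + n / (R - r) with hK₁
  have hK₁0 : 0 ≤ K₁ := by
    have : 0 < R - r := by linarith
    positivity
  have hK₁B : K₁ ≤ 54 * (B * r / δ ^ 2) := by
    have h1 : 2 * R / (R - r) ^ 2 ≤ 36 * r / δ ^ 2 := by
      have h3 : (δ / 3) ^ 2 ≤ (R - r) ^ 2 := pow_le_pow_left₀ (by positivity) hRr 2
      calc 2 * R / (R - r) ^ 2 ≤ (4 * r) / (δ / 3) ^ 2 := by
            refine div_le_div₀ (by linarith) (by linarith) (by positivity) h3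
        _ = _ := by field_simp; ring
    have h2 : n / (R - r) ≤ 18 * (B * r / δ ^ 2) := by
      calc n / (R - r) ≤ (6 * B * r / δ) / (δ / 3) := by
            refine div_le_div₀ (by positivity) hnB (by positivity) hRr
        _ = _ := by field_simp; ring
    have h4 : 2 * R / (R - r) ^ 2 * c ≤ 36 * r / δ ^ 2 * B :=
      mul_le_mul h1 hcB hc0 (by positivity)
    have h5 : 36 * r / δ ^ 2 * B = 36 * (B * r / δ ^ 2) := by ring
    linarith
  have hsqrt : √K₁ ≤ 8 * (B * r / δ) := by
    rw [Real.sqrt_le_left (by positivity)]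
    refine hK₁B.trans ?_
    have h1 : B * r / δ ^ 2 ≤ (B * r / δ) ^ 2 := by
      rw [div_pow]
      refine div_le_div_of_nonneg_right ?_ (by positivity)
      have : 1 ≤ B * r := by nlinarith
      nlinarith
    nlinarith [sq_nonneg (B * r / δ)]
  have hr0 : 0 < r := by linarith
  -- Square roots are taken because 1/|z − u| is not integrable over a circle through u, while its
  -- square root has mean at most 2/√r.
  set X : ℂ → ℝ := fun z => √K₁ + ∑ u ∈ hfin.toFinset, |(D u : ℝ)| * (√‖z - u‖)⁻¹ with hX
  have hXi : ∀ u ∈ hfin.toFinset,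
      CircleIntegrable (fun z => |(D u : ℝ)| * (√‖z - u‖)⁻¹) 0 r := fun u _ =>
    IntervalIntegrable.const_mul (circleAverage_inv_sqrt_norm_sub_le hr0 u).1 _
  have hXs : CircleIntegrable (fun z => ∑ u ∈ hfin.toFinset, |(D u : ℝ)| * (√‖z - u‖)⁻¹) 0 r := by
    have := CircleIntegrable.sum hfin.toFinset hXi
    rwa [Finset.sum_fn] at this
  have hXint : CircleIntegrable X 0 r := (circleIntegrable_const _ _ _).add hXs
  have hXA : circleAverage X 0 r ≤ √K₁ + 2 * n := by
    rw [hX, circleAverage_fun_add (circleIntegrable_const _ _ _) hXs, circleAverage_const,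
      circleAverage_fun_sum hXi]
    refine add_le_add le_rfl ?_
    rw [hn, Finset.mul_sum]
    refine Finset.sum_le_sum fun u _ => ?_
    have h1 := circleAverage_fun_smul (a := |(D u : ℝ)|) (f := fun z => (√‖z - u‖)⁻¹)
      (c := 0) (R := r)
    simp only [smul_eq_mul] at h1
    rw [h1, mul_comm 2]
    refine mul_le_mul_of_nonneg_left ?_ (abs_nonneg _)
    refine (circleAverage_inv_sqrt_norm_sub_le hr0 u).2.trans ?_
    exact div_le_self (by norm_num) (Real.one_le_sqrt.2 hr)
  have hprox := proximity_le_two_mul_log (g := logDeriv f) hf.logDeriv hr0.ne' hXint hXA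
    (by positivity) (by
      rw [abs_of_pos hr0]
      filter_upwards [norm_logDeriv_le hf hftop hr0.le hrR hsph (S := hfin.toFinset) (by rw [← hD]; simp)]
        with z hz
      refine (Real.sqrt_le_sqrt hz).trans ?_
      refine (sqrt_add_sum_le _ _ hK₁0 fun u _ => by positivity).trans ?_
      refine add_le_add le_rfl (Finset.sum_le_sum fun u _ => ?_)
      rw [Real.sqrt_mul (abs_nonneg _), Real.sqrt_inv]
      refine mul_le_mul_of_nonneg_right ?_ (by positivity)
      -- The multiplicities are integers, so √|D u| ≤ |D u|.
      rw [Real.sqrt_le_left (abs_nonneg _)]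
      rcases eq_or_ne (D u) 0 with h0 | h0
      · rw [h0]; simp
      · have : (1 : ℝ) ≤ |(D u : ℝ)| := by exact_mod_cast Int.one_le_abs h0
        nlinarith)
  refine hprox.trans ?_
  -- In units of B r/δ ≥ 1 the three terms are at most 1, 8 and 2·6.
  have hfinal : 1 + (√K₁ + 2 * n) ≤ 21 * B * r / δ := by
    have h1 : 1 ≤ B * r / δ := by
      rw [le_div_iff₀ hδ]; nlinarith
    have h2 : 6 * B * r / δ = 6 * (B * r / δ) := by ring
    have h3 : 21 * B * r / δ = 21 * (B * r / δ) := by ring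
    rw [h2] at hnB
    rw [h3]; linarith
  have := Real.log_le_log (by positivity) hfinal
  linarith

/-- Borel's growth lemma for a nondecreasing function `U ≥ 1`. -/
theorem exists_finite_measure_growth {U : ℝ → ℝ} (hU : MonotoneOn U (Ioi 0))
    (hU1 : ∀ r, 1 ≤ U r) :
    ∃ E : Set ℝ, E ⊆ Ioi 0 ∧ MeasurableSet E ∧ MeasureTheory.volume E < ⊤ ∧
      ∀ r, 0 < r → r ∉ E → U (r + 1 / U r) ≤ 2 * U r := by
  set E₀ : Set ℝ := {r | 0 < r ∧ 2 * U r < U (r + 1 / U r)} with hE₀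
  -- Dyadic levels of U. From a bad point x of level n, U has more than doubled at x + 1/U(x) and
  -- left the level; so the level has diameter at most 2⁻ⁿ, and these bounds sum to a finite
  -- measure.
  set L : ℕ → Set ℝ := fun n => {r ∈ E₀ | (2 : ℝ) ^ n ≤ U r ∧ U r < 2 ^ (n + 1)} with hL
  have hcover : E₀ ⊆ ⋃ n, L n := by
    intro r hr
    obtain ⟨n, hn⟩ := exists_nat_pow_near (hU1 r) (by norm_num : (1 : ℝ) < 2)
    exact mem_iUnion.2 ⟨n, hr, hn⟩
  have hdist : ∀ n, ∀ x ∈ L n, ∀ y ∈ L n, x ≤ y → y - x ≤ (1 / 2) ^ n := by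
    intro n x hx y hy hxy
    have hUx : 0 < U x := lt_of_lt_of_le one_pos (hU1 x)
    have h1 : y < x + 1 / U x := by
      by_contra! hcon
      have h2 : U (x + 1 / U x) ≤ U y :=
        hU (by simp only [mem_Ioi]; have := hx.1.1; positivity) hy.1.1 hcon
      have h3 := hx.1.2
      have h4 := hx.2.1
      have h5 := hy.2.2
      rw [pow_succ] at h5
      linarith
    have h6 : 1 / U x ≤ (1 / 2) ^ n := by
      rw [one_div_pow]
      exact one_div_le_one_div_of_le (by positivity) hx.2.1
    linarith
  have hvol : ∀ n, MeasureTheory.volume (L n) ≤ ENNReal.ofReal ((1 / 2) ^ n) := by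
    intro n
    refine (Real.volume_le_diam _).trans (Metric.ediam_le fun x hx y hy => ?_)
    rw [edist_dist, Real.dist_eq]
    refine ENNReal.ofReal_le_ofReal ?_
    rcases le_total x y with h | h
    · rw [abs_sub_comm, abs_of_nonneg (by linarith)]; exact hdist n x hx y hy h
    · rw [abs_of_nonneg (by linarith)]; exact hdist n y hy x hx h
  have hE₀vol : MeasureTheory.volume E₀ < ⊤ := by
    refine ((MeasureTheory.measure_mono hcover).trans
      (MeasureTheory.measure_iUnion_le _)).trans_lt ?_
    refine (ENNReal.tsum_le_tsum hvol).trans_lt ?_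
    have hs : Summable fun n : ℕ => ((1 : ℝ) / 2) ^ n :=
      summable_geometric_of_lt_one (by norm_num) (by norm_num)
    rw [← ENNReal.ofReal_tsum_of_nonneg (fun n => by positivity) hs]
    exact ENNReal.ofReal_lt_top
  refine ⟨MeasureTheory.toMeasurable MeasureTheory.volume E₀ ∩ Ioi 0, inter_subset_right,
    (MeasureTheory.measurableSet_toMeasurable _ _).inter measurableSet_Ioi, ?_, ?_⟩
  · refine (MeasureTheory.measure_mono inter_subset_left).trans_lt ?_
    rwa [MeasureTheory.measure_toMeasurable]
  · intro r hr hrE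
    by_contra! hcon
    exact hrE ⟨MeasureTheory.subset_toMeasurable _ _ ⟨hr, hcon⟩, hr⟩

/-- **Lemma on the logarithmic derivative**: outside a set of finite measure, `m(r, f'/f)` is
`O(log r + log⁺ T(r, f))`. -/
theorem exists_proximity_logDeriv_le {f : ℂ → ℂ} (hf : Meromorphic f)
    (hftop : ∀ z, meromorphicOrderAt f z ≠ ⊤) :
    ∃ E : Set ℝ, E ⊆ Ioi 0 ∧ MeasurableSet E ∧ MeasureTheory.volume E < ⊤ ∧ ∃ C : ℝ,
      ∀ r, 1 ≤ r → r ∉ E →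
        proximity (logDeriv f) ⊤ r ≤ C + 2 * Real.log r + 4 * Real.log (max 1 (T r f)) := by
  have hU : MonotoneOn (fun r => max 1 (T r f)) (Ioi 0) := fun x hx y hy hxy =>
    max_le_max le_rfl (characteristic_monotoneOn hf hx hy hxy)
  obtain ⟨E, hE0, hEm, hEv, hE⟩ := exists_finite_measure_growth hU fun r => le_max_left _ _
  set K := |Real.log ‖meromorphicTrailingCoeffAt f 0‖| with hK
  have hK0 : 0 ≤ K := abs_nonneg _
  refine ⟨E, hE0, hEm, hEv, 2 * Real.log (21 * (5 + K)), fun r hr hrE => ?_⟩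
  have hr0 : 0 < r := by linarith
  have h1 := hE r hr0 hrE
  set U := max 1 (T r f) with hUdef
  have hU1 : 1 ≤ U := le_max_left _ _
  -- With δ = 1/U Borel's lemma gives T(r + δ, f) ≤ 2U, and dividing by δ costs one more factor U:
  -- hence U² inside the logarithm.
  have h2 := proximity_logDeriv_le hf hftop hr (show 0 < 1 / U by positivity)
    ((div_le_one (by linarith)).2 hU1)
  have h3 : T (r + 1 / U) f ≤ 2 * U := (le_max_right _ _).trans h1
  have hT0 : 0 ≤ T (r + 1 / U) f := T_nonneg (by
    have : 0 < 1 / U := by positivity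
    linarith)
  have h4 : 21 * (2 * T (r + 1 / U) f + K + 1) * r / (1 / U) ≤ 21 * (5 + K) * r * U ^ 2 := by
    rw [div_div_eq_mul_div, div_one]
    have h5 : 2 * T (r + 1 / U) f + K + 1 ≤ (5 + K) * U := by nlinarith
    have h6 : 0 ≤ 21 * r * U := by positivity
    nlinarith [mul_le_mul_of_nonneg_left h5 h6]
  have h7 : Real.log (21 * (5 + K) * r * U ^ 2) =
      Real.log (21 * (5 + K)) + Real.log r + 2 * Real.log U := by
    rw [Real.log_mul (by positivity) (by positivity), Real.log_mul (by positivity) hr0.ne',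
      Real.log_pow]
    push_cast; ring
  have h8 := Real.log_le_log (by positivity) h4
  rw [h7] at h8
  linarith

/-! ### Error terms -/

/-- `s = O(T(r, f))` outside a set of finite measure. -/
def IsBigError (f : ℂ → ℂ) (s : ℝ → ℝ) : Prop :=
  ∃ E : Set ℝ, E ⊆ Set.Ioi 0 ∧ MeasurableSet E ∧ MeasureTheory.volume E < ⊤ ∧
    s =O[atTop ⊓ 𝓟 Eᶜ] fun r => T r f

theorem inf_principal_compl_union_le_left (l : Filter ℝ) (E F : Set ℝ) :
    l ⊓ 𝓟 (E ∪ F)ᶜ ≤ l ⊓ 𝓟 Eᶜ :=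
  inf_le_inf_left _ (principal_mono.2 (compl_subset_compl.2 subset_union_left))

theorem inf_principal_compl_union_le_right (l : Filter ℝ) (E F : Set ℝ) :
    l ⊓ 𝓟 (E ∪ F)ᶜ ≤ l ⊓ 𝓟 Fᶜ :=
  inf_le_inf_left _ (principal_mono.2 (compl_subset_compl.2 subset_union_right))

namespace IsSmallError

variable {f : ℂ → ℂ} {s t : ℝ → ℝ}

theorem add (hs : IsSmallError f s) (ht : IsSmallError f t) :
    IsSmallError f fun r => s r + t r := by
  obtain ⟨E, hE0, hEm, hEv, hE⟩ := hs
  obtain ⟨F, hF0, hFm, hFv, hF⟩ := ht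
  refine ⟨E ∪ F, union_subset hE0 hF0, hEm.union hFm,
    (MeasureTheory.measure_union_le _ _).trans_lt (ENNReal.add_lt_top.2 ⟨hEv, hFv⟩), ?_⟩
  exact (hE.mono (inf_principal_compl_union_le_left _ _ _)).add
    (hF.mono (inf_principal_compl_union_le_right _ _ _))

theorem const_mul (c : ℝ) (hs : IsSmallError f s) : IsSmallError f fun r => c * s r := by
  obtain ⟨E, hE0, hEm, hEv, hE⟩ := hs
  exact ⟨E, hE0, hEm, hEv, hE.const_mul_left c⟩

theorem of_isLittleO (h : s =o[atTop] fun r => T r f) : IsSmallError f s :=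
  ⟨∅, empty_subset _, MeasurableSet.empty, by simp, h.mono inf_le_left⟩

theorem zero : IsSmallError f fun _ => 0 := of_isLittleO (isLittleO_zero _ _)

theorem sum {ι : Type*} {u : ι → ℝ → ℝ} (A : Finset ι) (h : ∀ i ∈ A, IsSmallError f (u i)) :
    IsSmallError f fun r => ∑ i ∈ A, u i r := by
  classical
  induction A using Finset.induction with
  | empty => simpa using zero
  | insert i A hi ih =>
    simp only [Finset.sum_insert hi]
    exact (h i (by simp)).add (ih fun j hj => h j (by simp [hj]))

theorem of_le_of_notMem {F : Set ℝ} (hF0 : F ⊆ Ioi 0) (hFm : MeasurableSet F)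
    (hFv : MeasureTheory.volume F < ⊤) (ht : IsSmallError f t)
    (h0 : ∀ r, 1 ≤ r → 0 ≤ s r) (h : ∀ r, 1 ≤ r → r ∉ F → s r ≤ t r) : IsSmallError f s := by
  obtain ⟨E, hE0, hEm, hEv, hE⟩ := ht
  refine ⟨E ∪ F, union_subset hE0 hF0, hEm.union hFm,
    (MeasureTheory.measure_union_le _ _).trans_lt (ENNReal.add_lt_top.2 ⟨hEv, hFv⟩), ?_⟩
  refine IsBigO.trans_isLittleO (IsBigO.of_bound 1 ?_)
    (hE.mono (inf_principal_compl_union_le_left _ _ _))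
  have h1 : ∀ᶠ r in atTop ⊓ 𝓟 (E ∪ F)ᶜ, (1 : ℝ) ≤ r :=
    (eventually_ge_atTop (1 : ℝ)).filter_mono inf_le_left
  have h2 : ∀ᶠ r in atTop ⊓ 𝓟 (E ∪ F)ᶜ, r ∈ (E ∪ F)ᶜ :=
    (eventually_principal.2 fun _ h => h).filter_mono inf_le_right
  filter_upwards [h1, h2] with r hr hrF
  have hs := h r hr fun hmem => hrF (Or.inr hmem)
  rw [one_mul, Real.norm_of_nonneg (h0 r hr), Real.norm_of_nonneg ((h0 r hr).trans hs)]
  exact hs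

theorem of_le (ht : IsSmallError f t)
    (h0 : ∀ r, 1 ≤ r → 0 ≤ s r) (h : ∀ r, 1 ≤ r → s r ≤ t r) : IsSmallError f s :=
  of_le_of_notMem (empty_subset _) MeasurableSet.empty (by simp) ht h0 fun r hr _ => h r hr

theorem const (hf : IsTranscendentalMeromorphic f) (c : ℝ) : IsSmallError f fun _ => c :=
  of_isLittleO ((isLittleO_const_left.2 (Or.inr
    (tendsto_norm_atTop_atTop.comp Real.tendsto_log_atTop))).trans (isLittleO_log_T hf))

theorem isBigError (h : IsSmallError f s) : IsBigError f s := by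
  obtain ⟨E, hE0, hEm, hEv, hE⟩ := h
  exact ⟨E, hE0, hEm, hEv, hE.isBigO⟩

end IsSmallError

theorem tendsto_T_atTop {f : ℂ → ℂ} (hf : IsTranscendentalMeromorphic f) :
    Tendsto (fun r => T r f) atTop atTop := by
  have h : Tendsto (fun r => ‖T r f‖) atTop atTop := by
    have h1 := (isLittleO_log_T hf).bound (c := 1) one_pos
    refine tendsto_atTop_mono' _ ?_ (tendsto_norm_atTop_atTop.comp Real.tendsto_log_atTop)
    filter_upwards [h1] with r hr
    simpa using hr
  refine h.congr' ?_
  filter_upwards [eventually_ge_atTop 1] with r hr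
  exact Real.norm_of_nonneg (T_nonneg hr)

namespace IsBigError

variable {f : ℂ → ℂ} {s t : ℝ → ℝ}

theorem self (f : ℂ → ℂ) : IsBigError f fun r => T r f :=
  ⟨∅, empty_subset _, MeasurableSet.empty, by simp, isBigO_refl _ _⟩

theorem add (hs : IsBigError f s) (ht : IsBigError f t) :
    IsBigError f fun r => s r + t r := by
  obtain ⟨E, hE0, hEm, hEv, hE⟩ := hs
  obtain ⟨F, hF0, hFm, hFv, hF⟩ := ht
  refine ⟨E ∪ F, union_subset hE0 hF0, hEm.union hFm,
    (MeasureTheory.measure_union_le _ _).trans_lt (ENNReal.add_lt_top.2 ⟨hEv, hFv⟩), ?_⟩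
  exact (hE.mono (inf_principal_compl_union_le_left _ _ _)).add
    (hF.mono (inf_principal_compl_union_le_right _ _ _))

theorem const_mul (c : ℝ) (hs : IsBigError f s) : IsBigError f fun r => c * s r := by
  obtain ⟨E, hE0, hEm, hEv, hE⟩ := hs
  exact ⟨E, hE0, hEm, hEv, hE.const_mul_left c⟩

theorem sum {ι : Type*} {u : ι → ℝ → ℝ} (A : Finset ι) (h : ∀ i ∈ A, IsBigError f (u i)) :
    IsBigError f fun r => ∑ i ∈ A, u i r := by
  classical
  induction A using Finset.induction with
  | empty => simpa using IsSmallError.zero.isBigError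
  | insert i A hi ih =>
    simp only [Finset.sum_insert hi]
    exact (h i (by simp)).add (ih fun j hj => h j (by simp [hj]))

theorem of_le (ht : IsBigError f t)
    (h0 : ∀ r, 1 ≤ r → 0 ≤ s r) (h : ∀ r, 1 ≤ r → s r ≤ t r) : IsBigError f s := by
  obtain ⟨E, hE0, hEm, hEv, hE⟩ := ht
  refine ⟨E, hE0, hEm, hEv, (IsBigO.of_bound 1 ?_).trans hE⟩
  filter_upwards [(eventually_ge_atTop (1 : ℝ)).filter_mono inf_le_left] with r hr
  rw [one_mul, Real.norm_of_nonneg (h0 r hr), Real.norm_of_nonneg ((h0 r hr).trans (h r hr))]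
  exact h r hr

/-- T(r, f) → ∞ and log x = o(x); this absorbs the log⁺ T term of the logarithmic derivative lemma.
-/
theorem log_max_one (hf : IsTranscendentalMeromorphic f) (ht : IsBigError f t) :
    IsSmallError f fun r => Real.log (max 1 (t r)) := by
  obtain ⟨E, hE0, hEm, hEv, hE⟩ := ht
  refine ⟨E, hE0, hEm, hEv, ?_⟩
  obtain ⟨C, hC0, hC⟩ := hE.exists_pos
  have hT : Tendsto (fun r => C * T r f) (atTop ⊓ 𝓟 Eᶜ) atTop :=
    ((tendsto_T_atTop hf).mono_left inf_le_left).const_mul_atTop hC0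
  have h1 : (fun r => Real.log (C * T r f)) =o[atTop ⊓ 𝓟 Eᶜ] fun r => C * T r f :=
    Real.isLittleO_log_id_atTop.comp_tendsto hT
  refine IsBigO.trans_isLittleO (IsBigO.of_bound 1 ?_)
    (h1.trans_isBigO ((isBigO_refl _ _).const_mul_left C))
  filter_upwards [hC.bound, hT.eventually_ge_atTop 1,
    (eventually_ge_atTop (1 : ℝ)).filter_mono inf_le_left] with r hr hr1 hr2
  rw [Real.norm_of_nonneg (T_nonneg hr2)] at hr
  have h2 : max 1 (t r) ≤ C * T r f := max_le hr1 ((le_abs_self _).trans hr)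
  have h3 : 1 ≤ max 1 (t r) := le_max_left _ _
  rw [one_mul, Real.norm_of_nonneg (Real.log_nonneg h3), Real.norm_of_nonneg (Real.log_nonneg hr1)]
  exact Real.log_le_log (by linarith) h2

end IsBigError

/-- A set of finite measure does not contain a neighbourhood of `∞`. -/
theorem neBot_atTop_inf_principal_compl {E : Set ℝ} (hE : MeasureTheory.volume E < ⊤) :
    (atTop ⊓ 𝓟 Eᶜ).NeBot := by
  rw [neBot_iff, Ne, ← mem_iff_inf_principal_compl]
  intro h
  obtain ⟨a, ha⟩ := mem_atTop_sets.1 h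
  have : MeasureTheory.volume (Ici a) ≤ MeasureTheory.volume E := MeasureTheory.measure_mono ha
  rw [Real.volume_Ici] at this
  exact this.not_gt hE

theorem not_isSmallError_T {f : ℂ → ℂ} (hf : IsTranscendentalMeromorphic f) :
    ¬ IsSmallError f fun r => T r f := by
  rintro ⟨E, -, -, hEv, hE⟩
  have := neBot_atTop_inf_principal_compl hEv
  have h1 := hE.bound (c := 1 / 2) (by norm_num)
  obtain ⟨r, hr, hr1⟩ := (h1.and (((tendsto_T_atTop hf).eventually_ge_atTop 1).filter_mono
    inf_le_left)).exists
  rw [Real.norm_of_nonneg (by linarith)] at hr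
  linarith

/-- Lemma on the logarithmic derivative for functions of growth comparable with `f`. -/
theorem isSmallError_proximity_logDeriv {f g : ℂ → ℂ} (hf : IsTranscendentalMeromorphic f)
    (hg : Meromorphic g) (hgtop : ∀ z, meromorphicOrderAt g z ≠ ⊤)
    (hT : IsBigError f fun r => T r g) :
    IsSmallError f fun r => proximity (logDeriv g) ⊤ r := by
  obtain ⟨E, hE0, hEm, hEv, C, hC⟩ := exists_proximity_logDeriv_le hg hgtop
  refine IsSmallError.of_le_of_notMem hE0 hEm hEv
    (((IsSmallError.const hf C).add ((IsSmallError.of_isLittleO (isLittleO_log_T hf)).const_mul 2)).add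
      ((hT.log_max_one hf).const_mul 4)) (fun r _ => proximity_nonneg r) hC

/-! ### Derivatives -/

/-- A finite nonzero order drops by exactly one under differentiation, so only orders 0 and ⊤ are
compatible with a vanishing derivative. Subtracting the limit value rules out order 0. -/
theorem eventuallyEq_const_of_deriv {g : ℂ → ℂ} {z : ℂ} (hg : MeromorphicAt g z)
    (h : meromorphicOrderAt (deriv g) z = ⊤) : ∃ c, meromorphicOrderAt (fun w => g w - c) z = ⊤ := by
  have key : ∀ h : ℂ → ℂ, meromorphicOrderAt (deriv h) z = ⊤ →
      meromorphicOrderAt h z = 0 ∨ meromorphicOrderAt h z = ⊤ := by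
    intro h hh
    by_contra! hcon
    lift meromorphicOrderAt h z to ℤ using hcon.2 with n hn
    have := meromorphicOrderAt_deriv_eq_sub_one (Int.cast_ne_zero.2 (by simpa using hcon.1)) hn.symm
    rw [hh] at this
    exact WithTop.top_ne_coe this
  rcases key g h with h0 | h0
  · obtain ⟨c, -, hc⟩ := tendsto_ne_zero_of_meromorphicOrderAt_eq_zero hg h0
    refine ⟨c, (key (fun w => g w - c) (by simpa [deriv_sub_const_fun] using h)).resolve_left ?_⟩
    have hpos : 0 < meromorphicOrderAt (fun w => g w - c) z := by
      rw [← tendsto_zero_iff_meromorphicOrderAt_pos (by fun_prop)]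
      simpa using hc.sub_const c
    exact hpos.ne'
  · exact ⟨0, by simpa using h0⟩

/-- The normal form of g at z is analytic there, and so is its derivative. -/
theorem meromorphicOrderAt_deriv_nonneg {g : ℂ → ℂ} {z : ℂ} (hg : MeromorphicAt g z)
    (h : 0 ≤ meromorphicOrderAt g z) : 0 ≤ meromorphicOrderAt (deriv g) z := by
  have h1 := hg.eq_nhdsNE_toMeromorphicNFAt
  rw [meromorphicOrderAt_congr h1.nhdsNE_deriv]
  exact (hg.meromorphicOrderAt_nonneg_iff_analyticAt_toMeromorphicNFAt.1 h).deriv.meromorphicOrderAt_nonneg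

theorem exists_polynomial_derivative_eq (p : Polynomial ℂ) :
    ∃ P : Polynomial ℂ, Polynomial.derivative P = p := by
  induction p using Polynomial.induction_on' with
  | add p q hp hq =>
    obtain ⟨P, rfl⟩ := hp
    obtain ⟨Q, rfl⟩ := hq
    exact ⟨P + Q, by simp⟩
  | monomial n a =>
    refine ⟨Polynomial.monomial (n + 1) (a / (n + 1)), ?_⟩
    rw [Polynomial.derivative_monomial]
    congr 1
    push_cast
    exact div_mul_cancel₀ _ (by exact_mod_cast n.succ_ne_zero)

/-- Integration one derivative at a time: subtract a primitive of the polynomial found so far, and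
absorb the remaining local constant. -/
theorem exists_polynomial_of_iteratedDeriv {f : ℂ → ℂ} (hf : Meromorphic f) (z : ℂ) (n : ℕ)
    (h : meromorphicOrderAt (iteratedDeriv n f) z = ⊤) :
    ∃ P : Polynomial ℂ, meromorphicOrderAt (fun w => f w - P.eval w) z = ⊤ := by
  have key : ∀ i ≤ n, ∃ P : Polynomial ℂ,
      meromorphicOrderAt (fun w => iteratedDeriv (n - i) f w - P.eval w) z = ⊤ := by
    intro i hi
    induction i with
    | zero => exact ⟨0, by simpa using h⟩
    | succ i ih =>
      obtain ⟨P, hP⟩ := ih (by omega)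
      obtain ⟨Q, rfl⟩ := exists_polynomial_derivative_eq P
      have hm : Meromorphic (iteratedDeriv (n - (i + 1)) f) := by
        rw [iteratedDeriv_eq_iterate]; exact hf.iterated_deriv
      have hQ : Meromorphic fun w => Q.eval w := fun w =>
        (Q.differentiable.analyticAt w).meromorphicAt
      obtain ⟨c, hc⟩ := eventuallyEq_const_of_deriv (z := z) ((hm z).sub (hQ z)) <| by
        rw [← hP]
        refine meromorphicOrderAt_congr ?_
        filter_upwards [(hm z).eventually_analyticAt] with w hw
        have h1 : n - i = n - (i + 1) + 1 := by omega
        rw [h1, iteratedDeriv_succ, deriv_sub hw.differentiableAt Q.differentiable.differentiableAt,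
          Polynomial.deriv]
      refine ⟨Q + Polynomial.C c, ?_⟩
      rw [← hc]
      congr 1
      ext w
      simp [sub_sub]
  simpa using key n le_rfl

theorem meromorphic_iteratedDeriv {f : ℂ → ℂ} (hf : Meromorphic f) (n : ℕ) :
    Meromorphic (iteratedDeriv n f) := by
  rw [iteratedDeriv_eq_iterate]; exact hf.iterated_deriv

theorem meromorphicOrderAt_iteratedDeriv_ne_top {f : ℂ → ℂ} (hf : IsTranscendentalMeromorphic f)
    (n : ℕ) (z : ℂ) : meromorphicOrderAt (iteratedDeriv n f) z ≠ ⊤ := by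
  intro h
  obtain ⟨P, hP⟩ := exists_polynomial_of_iteratedDeriv hf.meromorphic z n h
  have hPm : Meromorphic fun w => P.eval w := fun w =>
    (P.differentiable.analyticAt w).meromorphicAt
  refine hf.not_isRational ⟨P, 1, one_ne_zero, ?_⟩
  filter_upwards [eventuallyEq_zero_of_meromorphicOrderAt_eq_top
    (f := fun w => f w - P.eval w) (fun w => (hf.meromorphic w).sub (hPm w)) hP] with w hw
  simpa [sub_eq_zero] using hw

theorem proximity_le_add_of_eventuallyEq_mul {f g h : ℂ → ℂ} (hg : Meromorphic g)
    (hh : Meromorphic h) (hfgh : f =ᶠ[codiscrete ℂ] g * h) {r : ℝ} (hr : r ≠ 0) :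
    proximity f ⊤ r ≤ proximity g ⊤ r + proximity h ⊤ r := by
  rw [proximity_congr_codiscrete hfgh hr]
  exact proximity_mul_top_le hg hh r

theorem eventually_codiscrete_ne_zero {g : ℂ → ℂ} (hg : Meromorphic g)
    (hgtop : ∀ z, meromorphicOrderAt g z ≠ ⊤) : ∀ᶠ z in codiscrete ℂ, g z ≠ 0 :=
  (meromorphicOn_univ.2 hg).eventually_codiscreteWithin_apply_ne_zero fun z _ => hgtop z

/-- A pole of order n ≥ 1 becomes one of order n + 1 ≤ 2n, and no other poles appear. -/
theorem logCounting_deriv_le {g : ℂ → ℂ} (hg : Meromorphic g) {r : ℝ} (hr : 1 ≤ r) :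
    ValueDistribution.logCounting (deriv g) ⊤ r ≤
      2 * ValueDistribution.logCounting g ⊤ r := by
  have h : (divisor (deriv g) univ)⁻ ≤ 2 • (divisor g univ)⁻ := by
    intro z
    have hm := meromorphicOn_univ.2 hg
    have hm' := meromorphicOn_univ.2 hg.deriv
    simp only [Function.locallyFinsuppWithin.negPart_apply, Function.locallyFinsuppWithin.coe_nsmul,
      Pi.smul_apply, hm.divisor_apply (mem_univ z), hm'.divisor_apply (mem_univ z)]
    rcases le_or_gt 0 (meromorphicOrderAt g z) with h0 | h0
    · have := meromorphicOrderAt_deriv_nonneg (hg z) h0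
      rw [negPart_eq_zero.2 (WithTop.untop₀_nonneg.2 this)]
      positivity
    · lift meromorphicOrderAt g z to ℤ using h0.ne_top with n hn
      have hn0 : n < 0 := by exact_mod_cast h0
      rw [meromorphicOrderAt_deriv_eq_sub_one (Int.cast_ne_zero.2 hn0.ne) hn.symm]
      simp only [WithTop.untop₀_coe, negPart_def, nsmul_eq_mul]
      push_cast
      omega
  have h2 := Function.locallyFinsuppWithin.logCounting_le h hr
  simpa [ValueDistribution.logCounting_top] using h2

theorem deriv_eventuallyEq_logDeriv_mul {g : ℂ → ℂ} (hg : Meromorphic g)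
    (hgtop : ∀ z, meromorphicOrderAt g z ≠ ⊤) : deriv g =ᶠ[codiscrete ℂ] logDeriv g * g := by
  filter_upwards [eventually_codiscrete_ne_zero hg hgtop] with z hz
  simp [logDeriv_apply, hz]

theorem isBigError_T_deriv {f g : ℂ → ℂ} (hf : IsTranscendentalMeromorphic f)
    (hg : Meromorphic g) (hgtop : ∀ z, meromorphicOrderAt g z ≠ ⊤)
    (hT : IsBigError f fun r => T r g) : IsBigError f fun r => T r (deriv g) := by
  refine ((isSmallError_proximity_logDeriv hf hg hgtop hT).isBigError.add
    (hT.const_mul 2)).of_le (fun r hr => T_nonneg hr) fun r hr => ?_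
  have h1 := proximity_le_add_of_eventuallyEq_mul hg.logDeriv hg
    (deriv_eventuallyEq_logDeriv_mul hg hgtop) (show r ≠ 0 by positivity)
  have h2 := logCounting_deriv_le hg hr
  have h3 : 0 ≤ proximity g ⊤ r := proximity_nonneg r
  rw [T_def, T_def]
  linarith

theorem isBigError_T_iteratedDeriv {f : ℂ → ℂ} (hf : IsTranscendentalMeromorphic f) (n : ℕ) :
    IsBigError f fun r => T r (iteratedDeriv n f) := by
  induction n with
  | zero => simpa using IsBigError.self f
  | succ n ih =>
    rw [iteratedDeriv_succ]
    exact isBigError_T_deriv hf (meromorphic_iteratedDeriv hf.meromorphic n)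
      (meromorphicOrderAt_iteratedDeriv_ne_top hf n) ih

/-- f⁽ⁿ⁾/f is the product of the logarithmic derivatives of f, f', …, f⁽ⁿ⁻¹⁾, each of characteristic
O(T(r, f)). -/
theorem isSmallError_proximity_iteratedDeriv_div {f : ℂ → ℂ} (hf : IsTranscendentalMeromorphic f)
    (n : ℕ) : IsSmallError f fun r => proximity (iteratedDeriv n f / f) ⊤ r := by
  have hm := meromorphic_iteratedDeriv hf.meromorphic
  have htop := meromorphicOrderAt_iteratedDeriv_ne_top hf
  induction n with
  | zero =>
    refine (IsSmallError.zero (f := f)).of_le (fun r _ => proximity_nonneg r) fun r hr => ?_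
    have : iteratedDeriv 0 f / f =ᶠ[codiscrete ℂ] fun _ => 1 := by
      filter_upwards [eventually_codiscrete_ne_zero (hm 0) (htop 0)] with z hz
      rw [iteratedDeriv_zero] at hz ⊢
      simp [hz]
    rw [proximity_congr_codiscrete this (by positivity)]
    simp
  | succ n ih =>
    refine ((isSmallError_proximity_logDeriv hf (hm n) (htop n)
      (isBigError_T_iteratedDeriv hf n)).add ih).of_le (fun r _ => proximity_nonneg r) fun r hr => ?_
    refine proximity_le_add_of_eventuallyEq_mul (hm n).logDeriv ((hm n).div hf.meromorphic) ?_
      (by positivity)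
    filter_upwards [deriv_eventuallyEq_logDeriv_mul (hm n) (htop n)] with z hz
    rw [Pi.div_apply, iteratedDeriv_succ, hz]
    simp [mul_div_assoc]

/-! ### Small functions -/

namespace IsSmallFunction

variable {f b : ℂ → ℂ}

theorem meromorphicOrderAt_ne_top (hb : IsSmallFunction f b) (z : ℂ) :
    meromorphicOrderAt b z ≠ ⊤ := fun h =>
  hb.not_zero (eventuallyEq_zero_of_meromorphicOrderAt_eq_top hb.meromorphic h)

theorem proximity (hb : IsSmallFunction f b) :
    IsSmallError f fun r => ValueDistribution.proximity b ⊤ r :=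
  hb.small.of_le (fun r _ => proximity_nonneg r) fun _ hr => proximity_le_T hr

theorem inv (hf : IsTranscendentalMeromorphic f) (hb : IsSmallFunction f b) :
    IsSmallFunction f b⁻¹ where
  meromorphic := hb.meromorphic.inv
  not_zero h := hb.not_zero <| by
    filter_upwards [h] with z hz
    simpa using hz
  small := (hb.small.add (IsSmallError.const hf _)).of_le (fun r hr => T_nonneg hr)
    fun r hr => T_inv_le hb.meromorphic (by positivity)

theorem logCounting_top (hb : IsSmallFunction f b) :
    IsSmallError f fun r => ValueDistribution.logCounting b ⊤ r :=
  hb.small.of_le (fun _ hr => logCounting_nonneg hr) fun _ _ => logCounting_le_T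

theorem logCounting_zero (hf : IsTranscendentalMeromorphic f) (hb : IsSmallFunction f b) :
    IsSmallError f fun r => ValueDistribution.logCounting b 0 r := by
  simpa using (hb.inv hf).logCounting_top

end IsSmallFunction

/-! ### The differential monomial -/

theorem coe_divisor_apply {g : ℂ → ℂ} (hg : Meromorphic g) {z : ℂ}
    (hz : meromorphicOrderAt g z ≠ ⊤) :
    ((divisor g univ z : ℤ) : WithTop ℤ) = meromorphicOrderAt g z := by
  rw [(meromorphicOn_univ.2 hg).divisor_apply (mem_univ z), WithTop.coe_untop₀_of_ne_top hz]

theorem diffMonomial_eq (a : ℂ → ℂ) (k : ℕ) (q : ℕ → ℕ) (f : ℂ → ℂ) :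
    diffMonomial a k q f = a * ∏ i ∈ Finset.range (k + 1), iteratedDeriv i f ^ q i := by
  ext z; simp [diffMonomial]

section monomial

variable {f a φ : ℂ → ℂ} (k : ℕ) (q : ℕ → ℕ)

theorem meromorphic_pow {g : ℂ → ℂ} (hg : Meromorphic g) (n : ℕ) : Meromorphic (g ^ n) :=
  fun z => (hg z).pow n

theorem meromorphic_diffMonomial (hf : Meromorphic f) (ha : Meromorphic a) :
    Meromorphic (diffMonomial a k q f) := by
  rw [diffMonomial_eq]
  exact ha.mul (Meromorphic.prod fun i _ => meromorphic_pow (meromorphic_iteratedDeriv hf i) _)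

theorem meromorphicOrderAt_pow_ne_top {g : ℂ → ℂ} {z : ℂ} (hg : MeromorphicAt g z)
    (h : meromorphicOrderAt g z ≠ ⊤) (n : ℕ) : meromorphicOrderAt (g ^ n) z ≠ ⊤ := by
  rw [meromorphicOrderAt_pow hg]
  lift meromorphicOrderAt g z to ℤ using h with m
  exact_mod_cast WithTop.coe_ne_top

theorem meromorphicOrderAt_mul_ne_top {g h : ℂ → ℂ} {z : ℂ} (hg : MeromorphicAt g z)
    (hh : MeromorphicAt h z) (hg' : meromorphicOrderAt g z ≠ ⊤)
    (hh' : meromorphicOrderAt h z ≠ ⊤) : meromorphicOrderAt (g * h) z ≠ ⊤ := by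
  rw [meromorphicOrderAt_mul hg hh]
  exact WithTop.add_ne_top.2 ⟨hg', hh'⟩

theorem meromorphicOrderAt_prod_ne_top {ι : Type*} {s : Finset ι} {g : ι → ℂ → ℂ} {z : ℂ}
    (hg : ∀ i ∈ s, MeromorphicAt (g i) z) (h : ∀ i ∈ s, meromorphicOrderAt (g i) z ≠ ⊤) :
    meromorphicOrderAt (∏ i ∈ s, g i) z ≠ ⊤ := by
  rw [meromorphicOrderAt_prod hg]
  exact WithTop.sum_ne_top.2 h

theorem meromorphicOrderAt_diffMonomial_ne_top (hf : IsTranscendentalMeromorphic f)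
    (ha : IsSmallFunction f a) (z : ℂ) : meromorphicOrderAt (diffMonomial a k q f) z ≠ ⊤ := by
  have hm := meromorphic_iteratedDeriv hf.meromorphic
  rw [diffMonomial_eq]
  exact meromorphicOrderAt_mul_ne_top (ha.meromorphic z)
    (MeromorphicAt.prod fun i _ => (hm i z).pow _) (ha.meromorphicOrderAt_ne_top z)
    (meromorphicOrderAt_prod_ne_top (fun i _ => (hm i z).pow _) fun i _ =>
      meromorphicOrderAt_pow_ne_top (hm i z) (meromorphicOrderAt_iteratedDeriv_ne_top hf i z) _)

theorem divisor_diffMonomial (hf : IsTranscendentalMeromorphic f) (ha : IsSmallFunction f a) :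
    divisor (diffMonomial a k q f) univ =
      divisor a univ + ∑ i ∈ Finset.range (k + 1), q i • divisor (iteratedDeriv i f) univ := by
  have hm := meromorphic_iteratedDeriv hf.meromorphic
  have hp : ∀ i z, meromorphicOrderAt (iteratedDeriv i f ^ q i) z ≠ ⊤ := fun i z =>
    meromorphicOrderAt_pow_ne_top (hm i z) (meromorphicOrderAt_iteratedDeriv_ne_top hf i z) _
  rw [diffMonomial_eq, divisor_mul (meromorphicOn_univ.2 ha.meromorphic)
    (meromorphicOn_univ.2 (Meromorphic.prod fun i _ => meromorphic_pow (hm i) _))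
    (fun z _ => ha.meromorphicOrderAt_ne_top z)
    (fun z _ => meromorphicOrderAt_prod_ne_top (fun i _ => (hm i z).pow _) fun i _ => hp i z),
    divisor_prod (fun i _ => meromorphicOn_univ.2 (meromorphic_pow (hm i) _)) fun i _ z _ => hp i z]
  congr 1
  exact Finset.sum_congr rfl fun i _ => divisor_pow (meromorphicOn_univ.2 (hm i)) _

theorem meromorphicOrderAt_iteratedDeriv_nonneg (hf : Meromorphic f) {z : ℂ}
    (hz : 0 ≤ meromorphicOrderAt f z) (i : ℕ) : 0 ≤ meromorphicOrderAt (iteratedDeriv i f) z := by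
  induction i with
  | zero => simpa using hz
  | succ i ih =>
    rw [iteratedDeriv_succ]
    exact meromorphicOrderAt_deriv_nonneg (meromorphic_iteratedDeriv hf i z) ih

/-- Where f has no pole its derivatives have none either, so only a can lower the order below that
of f^q₀. -/
theorem le_divisor_diffMonomial (hf : IsTranscendentalMeromorphic f) (ha : IsSmallFunction f a)
    {z : ℂ} (hz : 0 ≤ divisor f univ z) :
    divisor a univ z + q 0 * divisor f univ z ≤ divisor (diffMonomial a k q f) univ z := by
  have hm := meromorphic_iteratedDeriv hf.meromorphic
  rw [divisor_diffMonomial k q hf ha]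
  have hn : ∀ i, 0 ≤ divisor (iteratedDeriv i f) univ z := fun i => by
    have h1 := coe_divisor_apply (hm i) (meromorphicOrderAt_iteratedDeriv_ne_top hf i z)
    have h2 := coe_divisor_apply hf.meromorphic (meromorphicOrderAt_ne_top_of_not_isRational hf z)
    have h3 := meromorphicOrderAt_iteratedDeriv_nonneg hf.meromorphic (z := z)
      (by rw [← h2]; exact_mod_cast hz) i
    rw [← h1] at h3
    exact_mod_cast h3
  have h1 := Finset.single_le_sum (f := fun i => (q i : ℤ) * divisor (iteratedDeriv i f) univ z)
    (fun i _ => mul_nonneg (by positivity) (hn i)) (Finset.mem_range.2 k.succ_pos)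
  simp only [iteratedDeriv_zero] at h1
  simpa [Function.locallyFinsuppWithin.coe_add] using h1

theorem proximity_prod_le {ι : Type*} (s : Finset ι) {g : ι → ℂ → ℂ}
    (hg : ∀ i, Meromorphic (g i)) (r : ℝ) :
    proximity (∏ i ∈ s, g i) ⊤ r ≤ ∑ i ∈ s, proximity (g i) ⊤ r := by
  classical
  induction s using Finset.induction with
  | empty =>
    have : (1 : ℂ → ℂ) = fun _ => 1 := rfl
    simp [this]
  | insert i s hi ih =>
    rw [Finset.prod_insert hi, Finset.sum_insert hi]
    exact (proximity_mul_top_le (hg i) (Meromorphic.prod fun j _ => hg j) r).trans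
      (add_le_add le_rfl ih)

theorem T_mul_le {g h : ℂ → ℂ} (hg : Meromorphic g) (hg' : ∀ z, meromorphicOrderAt g z ≠ ⊤)
    (hh : Meromorphic h) (hh' : ∀ z, meromorphicOrderAt h z ≠ ⊤) {r : ℝ} (hr : 1 ≤ r) :
    T r (g * h) ≤ T r g + T r h :=
  characteristic_mul_top_le hr hg hg' hh hh'

theorem T_pow {g : ℂ → ℂ} (hg : Meromorphic g) (n : ℕ) (r : ℝ) : T r (g ^ n) = n * T r g := by
  simp [T, characteristic_pow_top hg]

theorem T_prod_le {ι : Type*} (s : Finset ι) {g : ι → ℂ → ℂ} (hg : ∀ i, Meromorphic (g i))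
    (hg' : ∀ i z, meromorphicOrderAt (g i) z ≠ ⊤) {r : ℝ} (hr : 1 ≤ r) :
    T r (∏ i ∈ s, g i) ≤ ∑ i ∈ s, T r (g i) := by
  classical
  induction s using Finset.induction with
  | empty =>
    have : (1 : ℂ → ℂ) = fun _ => 1 := rfl
    simp [this, T_def]
  | insert i s hi ih =>
    rw [Finset.prod_insert hi, Finset.sum_insert hi]
    exact (T_mul_le (hg i) (hg' i) (Meromorphic.prod fun j _ => hg j)
      (fun z => meromorphicOrderAt_prod_ne_top (fun j _ => hg j z) fun j _ => hg' j z) hr).trans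
      (add_le_add le_rfl ih)

theorem isBigError_T_diffMonomial (hf : IsTranscendentalMeromorphic f)
    (ha : IsSmallFunction f a) : IsBigError f fun r => T r (diffMonomial a k q f) := by
  have hm := meromorphic_iteratedDeriv hf.meromorphic
  have hp : ∀ i z, meromorphicOrderAt (iteratedDeriv i f ^ q i) z ≠ ⊤ := fun i z =>
    meromorphicOrderAt_pow_ne_top (hm i z) (meromorphicOrderAt_iteratedDeriv_ne_top hf i z) _
  refine (ha.small.isBigError.add (IsBigError.sum (Finset.range (k + 1)) fun i _ =>
    (isBigError_T_iteratedDeriv hf i).const_mul (q i))).of_le (fun r hr => T_nonneg hr)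
    fun r hr => ?_
  rw [diffMonomial_eq]
  refine (T_mul_le ha.meromorphic ha.meromorphicOrderAt_ne_top
    (Meromorphic.prod fun i _ => meromorphic_pow (hm i) _) (fun z => meromorphicOrderAt_prod_ne_top
      (fun i _ => (hm i z).pow _) fun i _ => hp i z) hr).trans (add_le_add le_rfl ?_)
  refine (T_prod_le _ (fun i => meromorphic_pow (hm i) _) hp hr).trans (le_of_eq ?_)
  exact Finset.sum_congr rfl fun i _ => T_pow (hm i) _ _

theorem isSmallError_proximity_diffMonomial_div (hf : IsTranscendentalMeromorphic f)
    (ha : IsSmallFunction f a) :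
    IsSmallError f fun r =>
      proximity (diffMonomial a k q f / f ^ ∑ i ∈ Finset.range (k + 1), q i) ⊤ r := by
  have hm := meromorphic_iteratedDeriv hf.meromorphic
  refine (ha.proximity.add (IsSmallError.sum (Finset.range (k + 1)) fun i _ =>
    (isSmallError_proximity_iteratedDeriv_div hf i).const_mul (q i))).of_le
    (fun r _ => proximity_nonneg r) fun r hr => ?_
  have heq : diffMonomial a k q f / f ^ ∑ i ∈ Finset.range (k + 1), q i =
      a * ∏ i ∈ Finset.range (k + 1), (iteratedDeriv i f / f) ^ q i := by
    rw [diffMonomial_eq, mul_div_assoc, ← Finset.prod_pow_eq_pow_sum]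
    simp_rw [div_pow]
    rw [Finset.prod_div_distrib]
  have hd : ∀ i, Meromorphic (iteratedDeriv i f / f) := fun i => (hm i).div hf.meromorphic
  rw [heq]
  refine (proximity_mul_top_le ha.meromorphic (Meromorphic.prod fun i _ => meromorphic_pow (hd i) _) r).trans
    (add_le_add le_rfl ((proximity_prod_le _ (fun i => meromorphic_pow (hd i) _) r).trans (le_of_eq ?_)))
  exact Finset.sum_congr rfl fun i _ => by simp [proximity_pow_top]

end monomial

theorem meromorphicOrderAt_eq_top_of_eventuallyEq_zero {g : ℂ → ℂ} (h : g =ᶠ[codiscrete ℂ] 0)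
    (z : ℂ) : meromorphicOrderAt g z = ⊤ := by
  rw [Filter.EventuallyEq, Filter.Eventually, mem_codiscrete] at h
  have := h z
  rw [disjoint_principal_right, compl_compl] at this
  exact meromorphicOrderAt_eq_top_iff.2 this

/-! ### Functions with nonvanishing derivative -/

theorem deriv_sub_const_eq (G : ℂ → ℂ) (c : ℂ) : deriv (fun z => G z - c) = deriv G := by
  ext z; simp [deriv_sub_const_fun]

/-- `t - m'` is the order of `(G - 1) / G'`, in terms of the order `m` of `G`. -/
theorem divisor_sub_one_cases {G : ℂ → ℂ} (hG : Meromorphic G)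
    (hGtop : ∀ z, meromorphicOrderAt G z ≠ ⊤)
    (hG1top : ∀ z, meromorphicOrderAt (fun w => G w - 1) z ≠ ⊤)
    (hG'top : ∀ z, meromorphicOrderAt (deriv G) z ≠ ⊤) (z : ℂ) {m t m' : ℤ}
    (hm : divisor G univ z = m) (ht : divisor (fun w => G w - 1) univ z = t)
    (hm' : divisor (deriv G) univ z = m') :
    (m ≠ 0 → m' = m - 1) ∧ (t ≠ 0 → m' = t - 1) ∧ (0 ≤ m → 0 ≤ m') ∧
      (m < 0 → t = m) ∧ (0 < m → t = 0) ∧ (m = 0 → 0 ≤ t) := by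
  have hG1 : Meromorphic fun w => G w - 1 := fun w => by have := hG w; fun_prop
  have em := coe_divisor_apply hG (hGtop z)
  have et := coe_divisor_apply hG1 (hG1top z)
  have em' := coe_divisor_apply hG.deriv (hG'top z)
  rw [hm] at em
  rw [ht] at et
  rw [hm'] at em'
  have hc : meromorphicOrderAt (fun _ : ℂ => (-1 : ℂ)) z = 0 := by
    simp [meromorphicOrderAt_const]
  have hadd : (fun w => G w - 1) = G + fun _ => -1 := by ext w; simp [sub_eq_add_neg]
  have hcm : MeromorphicAt (fun _ : ℂ => (-1 : ℂ)) z := MeromorphicAt.const _ _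
  have hne : m ≠ 0 → t = min m 0 := fun h => by
    have h1 := meromorphicOrderAt_add_of_ne (hG z) hcm (by rw [hc, ← em]; exact_mod_cast h)
    rw [← hadd, ← et, ← em, hc] at h1
    exact_mod_cast h1
  refine ⟨fun h => ?_, fun h => ?_, fun h => ?_, fun h => ?_, fun h => ?_, fun h => ?_⟩
  · have h1 := meromorphicOrderAt_deriv_eq_sub_one (Int.cast_ne_zero.2 h) em.symm
    rw [← em'] at h1
    exact_mod_cast h1
  · have h1 := meromorphicOrderAt_deriv_eq_sub_one (Int.cast_ne_zero.2 h) et.symm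
    rw [deriv_sub_const_eq, ← em'] at h1
    exact_mod_cast h1
  · have h1 := meromorphicOrderAt_deriv_nonneg (hG z) (by rw [← em]; exact_mod_cast h)
    rw [← em'] at h1
    exact_mod_cast h1
  · rw [hne h.ne, min_eq_left h.le]
  · rw [hne h.ne', min_eq_right h.le]
  · have h1 := meromorphicOrderAt_add (hG z) hcm
    rw [← hadd, ← et, ← em, hc, h] at h1
    simpa using h1

/-- With L = G'/(G−1) one has 1/G = 1 − L⁻¹·G'/G. Jensen's formula exchanges m(r, 1/L) for m(r, L)
plus the count of the divisor of 1/L; that signed count is kept so that zeros of G can contribute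
negatively. -/
theorem proximity_inv_le_logDeriv {G : ℂ → ℂ} (hG : Meromorphic G)
    (hGtop : ∀ z, meromorphicOrderAt G z ≠ ⊤)
    (hG1top : ∀ z, meromorphicOrderAt (fun w => G w - 1) z ≠ ⊤)
    (hG'top : ∀ z, meromorphicOrderAt (deriv G) z ≠ ⊤) :
    ∃ K : ℝ, ∀ r, 1 ≤ r → proximity G⁻¹ ⊤ r ≤ proximity (logDeriv G) ⊤ r +
      proximity (logDeriv fun w => G w - 1) ⊤ r +
      Function.locallyFinsuppWithin.logCounting
        (divisor (fun w => G w - 1) univ - divisor (deriv G) univ) r + K := by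
  have hG1 : Meromorphic fun w => G w - 1 := fun w => by have := hG w; fun_prop
  set L := logDeriv fun w => G w - 1 with hL
  have hLm : Meromorphic L := hG1.logDeriv
  have hLdiv : divisor L univ = divisor (deriv G) univ - divisor (fun w => G w - 1) univ := by
    have : L = deriv G * (fun w => G w - 1)⁻¹ := by
      ext w
      simp [hL, logDeriv_apply, deriv_sub_const_fun, div_eq_mul_inv]
    rw [this, divisor_mul (meromorphicOn_univ.2 hG.deriv) (meromorphicOn_univ.2 hG1.inv)
      (fun z _ => hG'top z), divisor_inv, sub_eq_add_neg]
    intro z _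
    rw [meromorphicOrderAt_inv]
    simpa using hG1top z
  refine ⟨|Real.log ‖meromorphicTrailingCoeffAt L 0‖| + Real.log 2, fun r hr => ?_⟩
  have hr0 : r ≠ 0 := by positivity
  have h1 := T_inv_le hLm hr0
  have h2 := congrFun (locallyFinsuppWithin.logCounting_divisor (f := L)) r
  rw [hLdiv] at h2
  rw [T_def, T_def, logCounting_inv] at h1
  rw [← neg_sub, map_neg]
  simp only [Pi.sub_apply, Pi.neg_apply] at h2 ⊢
  have h3 : G⁻¹ =ᶠ[codiscrete ℂ] (fun _ => 1) + (L⁻¹ * fun w => -logDeriv G w) := by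
    filter_upwards [eventually_codiscrete_ne_zero hG hGtop,
      eventually_codiscrete_ne_zero hG.deriv hG'top] with w hw hw'
    simp only [hL, Pi.inv_apply, Pi.add_apply, Pi.mul_apply, logDeriv_apply, deriv_sub_const_fun]
    field_simp
    ring
  have hneg : Meromorphic fun w => -logDeriv G w := hG.logDeriv.neg
  have h4 : proximity (fun w => -logDeriv G w) ⊤ r = proximity (logDeriv G) ⊤ r := by
    simp [proximity_top]
  have h5 := proximity_add_top_le (f₁ := fun _ => (1 : ℂ)) (Meromorphic.const 1)
    (hLm.inv.mul hneg) r
  have h6 := proximity_mul_top_le hLm.inv hneg r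
  rw [proximity_congr_codiscrete h3 hr0]
  simp only [Pi.add_apply, proximity_const, norm_one, posLog_one, h4] at h5 h6
  linarith

/-! ### The main estimate for the monomial. -/

section monomial

variable {f a φ : ℂ → ℂ} (k : ℕ) (q : ℕ → ℕ)

theorem T_le_T_inv {g : ℂ → ℂ} (hg : Meromorphic g) {r : ℝ} (hr : r ≠ 0) :
    T r g ≤ T r g⁻¹ + |Real.log ‖meromorphicTrailingCoeffAt g⁻¹ 0‖| := by
  simpa using T_inv_le hg.inv hr

/-- `m(r, 1 / f)` is controlled by the proximity function of `1 / M[f]`. -/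
theorem nsmul_proximity_inv_le (hf : IsTranscendentalMeromorphic f) (ha : IsSmallFunction f a)
    {r : ℝ} (hr : 1 ≤ r) :
    (∑ i ∈ Finset.range (k + 1), q i : ℕ) * proximity f⁻¹ ⊤ r ≤
      proximity (diffMonomial a k q f / f ^ ∑ i ∈ Finset.range (k + 1), q i) ⊤ r +
      proximity (diffMonomial a k q f)⁻¹ ⊤ r := by
  set γ := ∑ i ∈ Finset.range (k + 1), q i
  have hM := meromorphic_diffMonomial k q hf.meromorphic ha.meromorphic
  have h1 : f⁻¹ ^ γ =ᶠ[codiscrete ℂ]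
      (diffMonomial a k q f / f ^ γ) * (diffMonomial a k q f)⁻¹ := by
    filter_upwards [eventually_codiscrete_ne_zero hM
      (meromorphicOrderAt_diffMonomial_ne_top k q hf ha)] with z hz
    simp only [Pi.pow_apply, Pi.inv_apply, Pi.mul_apply, Pi.div_apply, inv_pow]
    field_simp
  have h2 := proximity_le_add_of_eventuallyEq_mul (hM.div (meromorphic_pow hf.meromorphic γ))
    hM.inv h1 (show r ≠ 0 by positivity)
  rw [proximity_pow_top] at h2
  simpa using h2

/-- The zeros of `f` are zeros of its monomials, up to the poles of `a`. -/
theorem logCounting_zero_le_diffMonomial (hf : IsTranscendentalMeromorphic f)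
    (ha : IsSmallFunction f a) (hq0 : 1 ≤ q 0) {r : ℝ} (hr : 1 ≤ r) :
    ValueDistribution.logCounting f 0 r ≤
      ValueDistribution.logCounting (diffMonomial a k q f) 0 r +
      ValueDistribution.logCounting a ⊤ r := by
  have h : (divisor f univ)⁺ ≤ (divisor (diffMonomial a k q f) univ)⁺ + (divisor a univ)⁻ := by
    intro z
    have h1 := le_divisor_diffMonomial k q hf ha (z := z)
    simp only [Function.locallyFinsuppWithin.coe_add, Pi.add_apply,
      Function.locallyFinsuppWithin.posPart_apply, Function.locallyFinsuppWithin.negPart_apply]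
    simp only [posPart_def, negPart_def]
    generalize divisor (diffMonomial a k q f) univ z = μ at *
    generalize divisor a univ z = α at *
    generalize divisor f univ z = p at *
    rcases le_or_gt 0 p with hp | hp
    · have h2 := h1 hp
      have h3 : p ≤ q 0 * p := le_mul_of_one_le_left hp (by exact_mod_cast hq0)
      omega
    · omega
  have h2 := Function.locallyFinsuppWithin.logCounting_le h hr
  simpa [ValueDistribution.logCounting_top, ValueDistribution.logCounting_zero] using h2

/-- `M[f] / φ` is not constant. -/
theorem meromorphicOrderAt_deriv_diffMonomial_div_ne_top (hf : IsTranscendentalMeromorphic f)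
    (ha : IsSmallFunction f a) (hφ : IsSmallFunction f φ) (hq0 : 1 ≤ q 0) (z : ℂ) :
    meromorphicOrderAt (deriv (diffMonomial a k q f / φ)) z ≠ ⊤ := by
  intro h
  have hM := meromorphic_diffMonomial k q hf.meromorphic ha.meromorphic
  have hMtop := meromorphicOrderAt_diffMonomial_ne_top k q hf ha
  have hG := hM.div hφ.meromorphic
  obtain ⟨c, hc⟩ := eventuallyEq_const_of_deriv (hG z) h
  have hGc : Meromorphic fun w => (diffMonomial a k q f / φ) w - c := fun w => by
    have := hG w; fun_prop
  have hMc : diffMonomial a k q f =ᶠ[codiscrete ℂ] (fun _ => c) * φ := by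
    filter_upwards [eventuallyEq_zero_of_meromorphicOrderAt_eq_top hGc hc,
      eventually_codiscrete_ne_zero hφ.meromorphic hφ.meromorphicOrderAt_ne_top] with w hw hw'
    have h1 : diffMonomial a k q f w / φ w = c := by simpa [sub_eq_zero] using hw
    rw [Pi.mul_apply, ← h1]
    field_simp
  have hc0 : c ≠ 0 := by
    rintro rfl
    refine hMtop z (meromorphicOrderAt_eq_top_of_eventuallyEq_zero ?_ z)
    filter_upwards [hMc] with w hw
    simpa using hw
  -- If M[f] = cφ is small, then m(r, 1/f) and N(r, 1/f) are both controlled by small terms, so T(r,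
  -- f) would be small compared with itself.
  have hT : IsSmallError f fun r => T r (diffMonomial a k q f) := by
    refine ((IsSmallError.const hf (log⁺ ‖c‖)).add hφ.small).of_le (fun r hr => T_nonneg hr)
      fun r hr => ?_
    have h1 : T r (diffMonomial a k q f) = T r ((fun _ => c) * φ) :=
      characteristic_congr_codiscrete hMc (by positivity)
    have h2 := T_mul_le (g := fun _ => c) (Meromorphic.const c)
      (fun z => by simp [meromorphicOrderAt_const, hc0]) hφ.meromorphic
      hφ.meromorphicOrderAt_ne_top hr
    rw [h1]
    simpa [T_def r (fun _ => c)] using h2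
  have hMsmall : IsSmallFunction f (diffMonomial a k q f) :=
    ⟨hM, fun h0 => hMtop z (meromorphicOrderAt_eq_top_of_eventuallyEq_zero h0 z), hT⟩
  refine not_isSmallError_T hf (((((isSmallError_proximity_diffMonomial_div k q hf ha).add
    (hMsmall.inv hf).proximity).add ((hMsmall.logCounting_zero hf).add ha.logCounting_top)).add
    (IsSmallError.const hf |Real.log ‖meromorphicTrailingCoeffAt f⁻¹ 0‖|)).of_le
    (fun r hr => T_nonneg hr) fun r hr => ?_)
  have h1 := nsmul_proximity_inv_le k q hf ha hr
  have h2 := logCounting_zero_le_diffMonomial k q hf ha hq0 hr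
  have h3 := T_le_T_inv hf.meromorphic (show r ≠ 0 by positivity)
  have h4 : (1 : ℝ) ≤ (∑ i ∈ Finset.range (k + 1), q i : ℕ) := by
    exact_mod_cast hq0.trans (Finset.single_le_sum (f := q) (fun i _ => Nat.zero_le _)
      (Finset.mem_range.2 k.succ_pos))
  have h5 : 0 ≤ proximity f⁻¹ ⊤ r := proximity_nonneg r
  have h6 := mul_le_mul_of_nonneg_right h4 h5
  rw [T_def r f⁻¹, logCounting_inv] at h3
  linarith

/-- The valence estimate: zeros of `f` of order `p` are zeros of `M[f]` of order at least
`q₀ p`, up to the zeros and poles of `a`. -/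
theorem logCounting_divisor_sub_le (hf : IsTranscendentalMeromorphic f)
    (ha : IsSmallFunction f a) (hφ : IsSmallFunction f φ) (hq0 : 1 ≤ q 0)
    (hG1top : ∀ z, meromorphicOrderAt (fun w => (diffMonomial a k q f / φ) w - 1) z ≠ ⊤)
    {r : ℝ} (hr : 1 ≤ r) :
    q 0 * ValueDistribution.logCounting f 0 r + Function.locallyFinsuppWithin.logCounting
      (divisor (fun w => (diffMonomial a k q f / φ) w - 1) univ -
        divisor (deriv (diffMonomial a k q f / φ)) univ) r ≤
      ValueDistribution.logCounting f 0 r + ValueDistribution.logCounting f ⊤ r +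
      ValueDistribution.logCounting (fun z => diffMonomial a k q f z - φ z) 0 r +
      (ValueDistribution.logCounting a 0 r + ValueDistribution.logCounting a ⊤ r) +
      (ValueDistribution.logCounting φ 0 r + ValueDistribution.logCounting φ ⊤ r) := by
  have hM := meromorphic_diffMonomial k q hf.meromorphic ha.meromorphic
  have hMtop := meromorphicOrderAt_diffMonomial_ne_top k q hf ha
  have hG := hM.div hφ.meromorphic
  have hφinv : ∀ z, meromorphicOrderAt φ⁻¹ z ≠ ⊤ := (hφ.inv hf).meromorphicOrderAt_ne_top
  have hGtop : ∀ z, meromorphicOrderAt (diffMonomial a k q f / φ) z ≠ ⊤ := fun z => by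
    rw [div_eq_mul_inv]
    exact meromorphicOrderAt_mul_ne_top (hM z) (hφ.meromorphic.inv z) (hMtop z) (hφinv z)
  have hG'top := meromorphicOrderAt_deriv_diffMonomial_div_ne_top k q hf ha hφ hq0
  have hGdiv : divisor (diffMonomial a k q f / φ) univ =
      divisor (diffMonomial a k q f) univ - divisor φ univ := by
    rw [div_eq_mul_inv, divisor_mul (meromorphicOn_univ.2 hM)
      (meromorphicOn_univ.2 hφ.meromorphic.inv) (fun z _ => hMtop z) (fun z _ => hφinv z),
      divisor_inv, sub_eq_add_neg]
  have hG1 : Meromorphic fun w => (diffMonomial a k q f / φ) w - 1 := fun w => by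
    have := hG w; fun_prop
  have hνdiv : divisor (fun z => diffMonomial a k q f z - φ z) univ =
      divisor φ univ + divisor (fun w => (diffMonomial a k q f / φ) w - 1) univ := by
    rw [← divisor_mul (meromorphicOn_univ.2 hφ.meromorphic) (meromorphicOn_univ.2 hG1)
      (fun z _ => hφ.meromorphicOrderAt_ne_top z) (fun z _ => hG1top z)]
    refine divisor_congr_codiscreteWithin ?_ isOpen_univ
    filter_upwards [eventually_codiscrete_ne_zero hφ.meromorphic hφ.meromorphicOrderAt_ne_top]
      with z hz
    simp only [Pi.mul_apply, Pi.div_apply]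
    field_simp
  -- Pointwise check. At a pole of f the bracket is at most 1, hence at most the pole order. At a
  -- zero of f the bracket 1 − m cancels q₀p up to 1 ≤ p. Elsewhere a zero of G − 1 is charged to
  -- M[f] − φ or to φ.
  have h : q 0 • (divisor f univ)⁺ + (divisor (fun w => (diffMonomial a k q f / φ) w - 1) univ -
        divisor (deriv (diffMonomial a k q f / φ)) univ) ≤
      (divisor f univ)⁺ + (divisor f univ)⁻ +
      (divisor (fun z => diffMonomial a k q f z - φ z) univ)⁺ +
      ((divisor a univ)⁺ + (divisor a univ)⁻) + ((divisor φ univ)⁺ + (divisor φ univ)⁻) := by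
    intro z
    have h1 := le_divisor_diffMonomial k q hf ha (z := z)
    have h2 := divisor_sub_one_cases hG hGtop hG1top hG'top z rfl rfl rfl
    rw [hνdiv]
    rw [hGdiv] at h2
    simp only [Function.locallyFinsuppWithin.coe_add, Function.locallyFinsuppWithin.coe_sub,
      Function.locallyFinsuppWithin.coe_nsmul, Pi.add_apply, Pi.sub_apply, Pi.smul_apply,
      Function.locallyFinsuppWithin.posPart_apply, Function.locallyFinsuppWithin.negPart_apply]
      at h2 ⊢
    simp only [posPart_def, negPart_def, nsmul_eq_mul]
    generalize divisor (fun w => (diffMonomial a k q f / φ) w - 1) univ z = t at *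
    generalize divisor (deriv (diffMonomial a k q f / φ)) univ z = m' at *
    generalize divisor (diffMonomial a k q f) univ z = μ at *
    generalize divisor a univ z = α at *
    generalize divisor φ univ z = β at *
    generalize divisor f univ z = p at *
    rcases le_or_gt 0 p with hp | hp
    · rw [sup_eq_left.2 hp]
      have h3 : p ≤ q 0 * p := le_mul_of_one_le_left hp (by exact_mod_cast hq0)
      -- Together with `h3`, this is all that `omega` needs about the nonlinear term once it is
      -- replaced by the opaque `X`.
      have h4 : p = 0 → (q 0 : ℤ) * p = 0 := fun h => by simp [h]
      have h5 := h1 hp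
      generalize (q 0 : ℤ) * p = X at *
      omega
    · rw [sup_eq_right.2 hp.le]
      omega
  have h2 := Function.locallyFinsuppWithin.logCounting_le h hr
  simpa [ValueDistribution.logCounting_top, ValueDistribution.logCounting_zero] using h2

/-- The main estimate, in multiplicative form. -/
theorem mul_T_le (hf : IsTranscendentalMeromorphic f) (ha : IsSmallFunction f a)
    (hφ : IsSmallFunction f φ) (hq0 : 1 ≤ q 0) :
    ∃ s, IsSmallError f s ∧ ∀ r, 1 ≤ r → ((q 0 : ℝ) - 2) * T r f ≤
      ValueDistribution.logCounting (fun z => diffMonomial a k q f z - φ z) 0 r + s r := by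
  have hM := meromorphic_diffMonomial k q hf.meromorphic ha.meromorphic
  have hMtop := meromorphicOrderAt_diffMonomial_ne_top k q hf ha
  have hφinv := hφ.inv hf
  have hG'top := meromorphicOrderAt_deriv_diffMonomial_div_ne_top k q hf ha hφ hq0
  have hvalence := fun h r hr => logCounting_divisor_sub_le k q hf ha hφ hq0 h (r := r) hr
  have hG := hM.div hφ.meromorphic
  have hGtop : ∀ z, meromorphicOrderAt (diffMonomial a k q f / φ) z ≠ ⊤ := fun z => by
    rw [div_eq_mul_inv]
    exact meromorphicOrderAt_mul_ne_top (hM z) (hφ.meromorphic.inv z) (hMtop z)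
      (hφinv.meromorphicOrderAt_ne_top z)
  have hGT : IsBigError f fun r => T r (diffMonomial a k q f / φ) := by
    refine ((isBigError_T_diffMonomial k q hf ha).add hφinv.small.isBigError).of_le
      (fun r hr => T_nonneg hr) fun r hr => ?_
    rw [div_eq_mul_inv]
    exact T_mul_le hM hMtop hφ.meromorphic.inv hφinv.meromorphicOrderAt_ne_top hr
  have hMinv : (diffMonomial a k q f)⁻¹ =ᶠ[codiscrete ℂ] (diffMonomial a k q f / φ)⁻¹ * φ⁻¹ := by
    filter_upwards [eventually_codiscrete_ne_zero hφ.meromorphic hφ.meromorphicOrderAt_ne_top]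
      with z hz
    simp only [Pi.inv_apply, Pi.mul_apply, Pi.div_apply]
    field_simp
  have hmono := fun r hr => nsmul_proximity_inv_le k q hf ha (r := r) hr
  have hsmall := isSmallError_proximity_diffMonomial_div k q hf ha
  have hγ : (q 0 : ℝ) ≤ (∑ i ∈ Finset.range (k + 1), q i : ℕ) := by
    exact_mod_cast Finset.single_le_sum (f := q) (fun i _ => Nat.zero_le _)
      (Finset.mem_range.2 k.succ_pos)
  generalize (∑ i ∈ Finset.range (k + 1), q i) = γ at *
  generalize diffMonomial a k q f = M at *
  -- If G − 1 vanished near z, so would G', against the nonconstancy of G.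
  have hG1top : ∀ z, meromorphicOrderAt (fun w => (M / φ) w - 1) z ≠ ⊤ := fun z h => by
    refine hG'top z ?_
    rw [← deriv_sub_const_eq _ 1, meromorphicOrderAt_congr (f₂ := fun _ => (0 : ℂ))]
    · simp [meromorphicOrderAt_const]
    · have h1 : (fun w => (M / φ) w - 1) =ᶠ[𝓝[≠] z] fun _ => 0 := meromorphicOrderAt_eq_top_iff.1 h
      simpa using! h1.nhdsNE_deriv
  have hG1 : Meromorphic fun w => (M / φ) w - 1 := fun w => by
    have := hG w; fun_prop
  have hG1T : IsBigError f fun r => T r fun w => (M / φ) w - 1 := by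
    refine (hGT.add (IsSmallError.const hf (Real.log 2)).isBigError).of_le
      (fun r hr => T_nonneg hr) fun r hr => ?_
    have h1 := characteristic_add_top_le hG (Meromorphic.const (-1 : ℂ)) hr
    have h2 : (fun w => (M / φ) w - 1) = M / φ + fun _ => -1 := by
      ext w; simp [sub_eq_add_neg]
    have h3 : characteristic (fun _ : ℂ => (-1 : ℂ)) ⊤ r = 0 := by simp [characteristic]
    rw [h3] at h1
    rw [h2]
    simpa [T] using h1
  obtain ⟨K, hK⟩ := proximity_inv_le_logDeriv hG hGtop hG1top hG'top
  set K₁ := |Real.log ‖meromorphicTrailingCoeffAt f⁻¹ 0‖|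
  set K₂ := |Real.log ‖meromorphicTrailingCoeffAt f 0‖|
  refine ⟨_, (((hsmall.add hφinv.proximity).add
    ((isSmallError_proximity_logDeriv hf hG hGtop hGT).add
      (isSmallError_proximity_logDeriv hf hG1 hG1top hG1T))).add
    (((ha.logCounting_zero hf).add ha.logCounting_top).add
      ((hφ.logCounting_zero hf).add hφ.logCounting_top))).add
    (IsSmallError.const hf (K + γ * K₁ + (γ - q 0 + 1) * K₂)), fun r hr => ?_⟩
  have hr0 : r ≠ 0 := by positivity
  have h1 := hmono r hr
  have h2 := proximity_le_add_of_eventuallyEq_mul hG.inv hφ.meromorphic.inv hMinv hr0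
  have h3 := hK r hr
  have h4 := hvalence hG1top r hr
  have h5 := T_le_T_inv hf.meromorphic hr0
  have h6 := logCounting_zero_le_T hf.meromorphic hr0
  have h7 : ValueDistribution.logCounting f ⊤ r ≤ T r f := logCounting_le_T
  rw [T_def r f⁻¹, logCounting_inv] at h5
  -- γ copies of T(r, f) ≤ m(r, 1/f) + N(r, 1/f) + O(1) are used; the γ − q₀ + 1 copies of N(r, 1/f)
  -- left over, a nonnegative number by `hγ`, are returned to T(r, f).
  have h8 := mul_le_mul_of_nonneg_left h5 (show (0 : ℝ) ≤ γ by positivity)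
  have h9 := mul_le_mul_of_nonneg_left h6 (show (0 : ℝ) ≤ γ - q 0 + 1 by linarith)
  linarith

end monomial

end Nevanlinna

end

theorem theorem2p4 (f a φ : ℂ → ℂ) (k : ℕ) (q : ℕ → ℕ)
    (hf : Nevanlinna.IsTranscendentalMeromorphic f)
    (ha : Nevanlinna.IsSmallFunction f a)
    (hφ : Nevanlinna.IsSmallFunction f φ)
    (hk : 1 ≤ k) (hq0 : 3 ≤ q 0) (hqk : 1 ≤ q k) :
    ∃ s : ℝ → ℝ, Nevanlinna.IsSmallError f s ∧
      ∀ r : ℝ, 0 < r →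
        Nevanlinna.T r f ≤
          1 / ((q 0 : ℝ) - 2) *
            Nevanlinna.N r (fun z => 1 / (Nevanlinna.diffMonomial a k q f z - φ z)) + s r := by
  obtain ⟨s, hs, hle⟩ := Nevanlinna.mul_T_le k q hf ha hφ (by omega)
  have hq : (0 : ℝ) < (q 0 : ℝ) - 2 := by
    have : (3 : ℝ) ≤ q 0 := by exact_mod_cast hq0
    linarith
  have hN : ∀ r, Nevanlinna.N r (fun z => 1 / (Nevanlinna.diffMonomial a k q f z - φ z)) =
      ValueDistribution.logCounting (fun z => Nevanlinna.diffMonomial a k q f z - φ z) 0 r := by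
    intro r
    rw [← ValueDistribution.logCounting_inv, Nevanlinna.N]
    congr 1
    ext z
    simp
  simp only [hN]
  obtain ⟨E, hE0, hEm, hEv, hE⟩ := hs.const_mul (1 / ((q 0 : ℝ) - 2))
  -- The estimate is known only for r ≥ 1. Below 1 the error is defined as the difference of the two
  -- sides, which does not affect its behaviour at infinity.
  refine ⟨fun r => if 1 ≤ r then 1 / ((q 0 : ℝ) - 2) * s r else
      Nevanlinna.T r f - 1 / ((q 0 : ℝ) - 2) * ValueDistribution.logCounting
        (fun z => Nevanlinna.diffMonomial a k q f z - φ z) 0 r, ⟨E, hE0, hEm, hEv, ?_⟩, ?_⟩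
  · refine hE.congr' ?_ EventuallyEq.rfl
    filter_upwards [(eventually_ge_atTop (1 : ℝ)).filter_mono inf_le_left] with r hr
    rw [if_pos hr]
  · intro r _
    beta_reduce
    split_ifs with hr
    · rw [← mul_add, one_div, inv_mul_eq_div, le_div_iff₀ hq, mul_comm]
      exact hle r hr
    · linarith
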